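/- **Conventions.** For $u\in\mathcal S'(\mathbb R^n)$ and $\varphi\in\mathcal S(\mathbb R^n)$, $\langle u,\varphi\rangle$ denotes the extension of the inner product $\int f\,\overline g$ of $L^2(\mathbb R^n)$. For a non-zero window $g\in\mathcal S(\mathbb R^n)$ put $V_gu(x,\omega)=\langle u,\,e^{2\pi i\,\omega\cdot(\,\cdot\,)}g(\cdot-x)\rangle$. For $1\le p,q\le\infty$ the modulation space $M^{p,q}(\mathbb R^n)$ is the set of all $u\in\mathcal S'(\mathbb R^n)$ with $$\|u\|_{M^{p,q}}=\Big(\int_{\mathbb R^n}\Big(\int_{\mathbb R^n}|V_gu(x,\omega)|^p\,dx\Big)^{q/p}d\omega\Big)^{1/q}<\infty$$ (essential suprema for infinite exponents), and $M^\infty=M^{\infty,\infty}$, which contains every $M^{p,q}$. The Sjöstrand class is $M^{\infty,1}(\mathbb R^{2d})$. Fix the windows that define the norms on $\mathbb R^d$ and on $\mathbb R^{2d}$ (any non-zero Schwartz functions). Let $A=\begin{pmatrix}A_{11}&A_{12}\\A_{21}&A_{22}\end{pmatrix}\in GL(2d,\mathbb R)$ with $d\times d$ blocks. It is *left-regular*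 if $A_{11}$ and $A_{21}$ are invertible. Put $A^\#=(A^{-1})^{\top}$ and let $(A^\#)_{ij}$ be the $d\times d$ blocks of $A^\#$. For $f,h\in\mathcal S(\mathbb R^d)$ let $$\mathcal B_A(h,f)(x,\omega)=\int_{\mathbb R^d}e^{-2\pi i\,y\cdot\omega}\,h(A_{11}x+A_{12}y)\,\overline{f(A_{21}x+A_{22}y)}\,dy ,$$ a Schwartz function on $\mathbb R^{2d}$. For $\sigma\in\mathcal S'(\mathbb R^{2d})$ the operator $\sigma^A:\mathcal S(\mathbb R^d)\to\mathcal S'(\mathbb R^d)$ is defined by $\langle\sigma^Af,h\rangle=\langle\sigma,\mathcal B_A(h,f)\rangle$ for $f,h\in\mathcal S(\mathbb R^d)$. **Theorem.** Let $A\in GL(2d,\mathbb R)$ be left-regular. There is a constant $C>0$, depending only on $A$ (hence on $d$) and on the two fixed windows, such that for every $\sigma\in M^{\infty,1}(\mathbb R^{2d})$ the operator $\sigma^A$ is bounded on all modulation spaces $M^{p,q}(\mathbb R^d)$, $1\le p,q\le\infty$, with $$\|\sigma^A\|_{M^{p,q}\to M^{p,q}}\le C\,\frac1{|\det A_{11}|^{1/p'}\,|\det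 A_{21}|^{1/p}}\cdot\frac1{|\det (A^\#)_{12}|^{1/q'}\,|\det (A^\#)_{22}|^{1/q}}\,\|\sigma\|_{M^{\infty,1}},$$ where $1/p+1/p'=1/q+1/q'=1$. Here boundedness means the following: $\sigma^A$ extends from $\mathcal S(\mathbb R^d)$ to a linear operator on $M^\infty(\mathbb R^d)$, with values in $\mathcal S'(\mathbb R^d)$, which is weak-$*$ continuous in the sense that it maps sequences that are bounded in $M^\infty$ and converge in $\mathcal S'$ (pointwise on $\mathcal S$) to sequences converging in $\mathcal S'$ to the image of the limit, and this one extension maps each $M^{p,q}(\mathbb R^d)$ into itself with the stated norm bound. -/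

import Mathlib

open MeasureTheory Filter Topology Matrix
open scoped SchwartzMap ENNReal NNReal ComplexConjugate

namespace MatrixWigner

noncomputable section

/-! ### Schwartz functions: conjugation and time-frequency shifts -/

/-- The character `t ↦ e^{2πi t·ω}` has temperate growth. -/
theorem character_hasTemperateGrowth {ι : Type*} [Fintype ι] (ω : EuclideanSpace ℝ ι) :
    (fun t : EuclideanSpace ℝ ι =>
      Complex.exp (2 * Real.pi * Complex.I * (inner ℝ t ω : ℝ))).HasTemperateGrowth := by
  have h1 : (fun s : ℝ => Complex.exp (2 * Real.pi * Complex.I * (s : ℂ))).HasTemperateGrowth := by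
    refine ⟨Complex.contDiff_exp.comp (contDiff_const.mul Complex.ofRealCLM.contDiff), fun n => ⟨0, ‖(2 * Real.pi * Complex.I : ℂ) ^ n‖, fun s => ?_⟩⟩
    have key : ∀ n : ℕ, iteratedDeriv n
        (fun s : ℝ => Complex.exp (2 * Real.pi * Complex.I * (s : ℂ))) =
        fun s : ℝ => (2 * Real.pi * Complex.I : ℂ) ^ n *
          Complex.exp (2 * Real.pi * Complex.I * (s : ℂ)) := by
      intro n
      induction n with
      | zero => simp
      | succ k ih =>
        rw [iteratedDeriv_succ, ih]
        funext s
        have h0 : HasDerivAt (fun s : ℝ => (2 * Real.pi * Complex.I : ℂ) * (s : ℂ))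
            ((2 * Real.pi * Complex.I : ℂ) * 1) s :=
          (Complex.ofRealCLM.hasDerivAt (x := s)).const_mul _
        rw [(h0.cexp.const_mul _).deriv]
        ring
    rw [norm_iteratedFDeriv_eq_norm_iteratedDeriv, key, norm_mul, Complex.norm_exp]
    simp
  exact h1.comp (Function.hasTemperateGrowth_inner_left ω)

/-- Complex conjugation `f ↦ f̄` on the Schwartz space. -/
def conjS {ι : Type*} [Fintype ι] (f : 𝓢(EuclideanSpace ℝ ι, ℂ)) :
    𝓢(EuclideanSpace ℝ ι, ℂ) :=
  SchwartzMap.postcompCLM (𝕜 := ℝ) (Complex.conjCLE : ℂ →L[ℝ] ℂ) f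

theorem conjS_apply {ι : Type*} [Fintype ι] (f : 𝓢(EuclideanSpace ℝ ι, ℂ))
    (t : EuclideanSpace ℝ ι) : conjS f t = conj (f t) := by
  simp [conjS]

/-- The time-frequency shift `π(x, ω) g = M_ω T_x g`. -/
def tfShift {ι : Type*} [Fintype ι] (x ω : EuclideanSpace ℝ ι)
    (g : 𝓢(EuclideanSpace ℝ ι, ℂ)) : 𝓢(EuclideanSpace ℝ ι, ℂ) :=
  SchwartzMap.smulLeftCLM ℂ
    (fun t : EuclideanSpace ℝ ι => Complex.exp (2 * Real.pi * Complex.I * (inner ℝ t ω : ℝ)))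
    (SchwartzMap.compSubConstCLM ℂ x g)

theorem tfShift_apply {ι : Type*} [Fintype ι] (x ω : EuclideanSpace ℝ ι)
    (g : 𝓢(EuclideanSpace ℝ ι, ℂ)) (t : EuclideanSpace ℝ ι) :
    tfShift x ω g t = Complex.exp (2 * Real.pi * Complex.I * (inner ℝ t ω : ℝ)) * g (t - x) := by
  simp [tfShift, SchwartzMap.smulLeftCLM_apply_apply (character_hasTemperateGrowth ω)]

/-! ### The short-time Fourier transform and modulation spaces -/

/-- The bracket `⟨u, φ⟩` of a tempered distribution and a Schwartz function that extends the
inner product `⟨f, g⟩ = ∫ f ḡ` of `L²` (linear in `u`, conjugate-linear in `φ`). -/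
def bracket {ι : Type*} [Fintype ι] (u : 𝓢'(EuclideanSpace ℝ ι, ℂ))
    (φ : 𝓢(EuclideanSpace ℝ ι, ℂ)) : ℂ :=
  u (conjS φ)

/-- The short-time Fourier transform `V_g u (x, ω) = ⟨u, π(x, ω) g⟩`. -/
def stft {ι : Type*} [Fintype ι] (g : 𝓢(EuclideanSpace ℝ ι, ℂ))
    (u : 𝓢'(EuclideanSpace ℝ ι, ℂ)) (x ω : EuclideanSpace ℝ ι) : ℂ :=
  bracket u (tfShift x ω g)

/-- The modulation space norm
`‖u‖_{M^{p,q}} = (∫ (∫ |V_g u (x, ω)|^p dx)^{q/p} dω)^{1/q}` computed with the window `g`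
(essential suprema for infinite exponents), as an element of `[0, ∞]`. -/
def modNorm {ι : Type*} [Fintype ι] (g : 𝓢(EuclideanSpace ℝ ι, ℂ)) (p q : ℝ≥0∞)
    (u : 𝓢'(EuclideanSpace ℝ ι, ℂ)) : ℝ≥0∞ :=
  eLpNorm (fun ω : EuclideanSpace ℝ ι =>
    eLpNorm (fun x : EuclideanSpace ℝ ι => stft g u x ω) p volume) q volume

/-- The modulation space `M^{p,q}` (for a non-zero window `g`). -/
def modSpace {ι : Type*} [Fintype ι] (g : 𝓢(EuclideanSpace ℝ ι, ℂ)) (p q : ℝ≥0∞) :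
    Set 𝓢'(EuclideanSpace ℝ ι, ℂ) :=
  {u | modNorm g p q u < ∞}

/-! ### Matrix-Wigner distributions and their pseudodifferential operators

`ℝ^{2d}` is `EuclideanSpace ℝ (Fin d ⊕ Fin d)`; a real `2d × 2d` matrix is indexed by
`Fin d ⊕ Fin d`, and its `d × d` blocks are `A.toBlocks₁₁`, …, `A.toBlocks₂₂`. -/

/-- The first half `x` of a point `(x, ω)` of `ℝ^{2d}`. -/
def fstHalf {d : ℕ} (z : EuclideanSpace ℝ (Fin d ⊕ Fin d)) : EuclideanSpace ℝ (Fin d) :=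
  WithLp.toLp 2 fun i => z (Sum.inl i)

/-- The second half `ω` of a point `(x, ω)` of `ℝ^{2d}`. -/
def sndHalf {d : ℕ} (z : EuclideanSpace ℝ (Fin d ⊕ Fin d)) : EuclideanSpace ℝ (Fin d) :=
  WithLp.toLp 2 fun i => z (Sum.inr i)

/-- The action of a `d × d` matrix on `ℝ^d`. -/
def matAct {d : ℕ} (B : Matrix (Fin d) (Fin d) ℝ) (x : EuclideanSpace ℝ (Fin d)) :
    EuclideanSpace ℝ (Fin d) :=
  WithLp.toLp 2 (B *ᵥ x.ofLp)

/-- The matrix-Wigner distribution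
`B_A(f, g)(x, ω) = ∫ e^{-2πi y·ω} f(A₁₁ x + A₁₂ y) conj(g(A₂₁ x + A₂₂ y)) dy`. -/
def matrixWigner {d : ℕ} (A : Matrix (Fin d ⊕ Fin d) (Fin d ⊕ Fin d) ℝ)
    (f g : 𝓢(EuclideanSpace ℝ (Fin d), ℂ)) (z : EuclideanSpace ℝ (Fin d ⊕ Fin d)) : ℂ :=
  ∫ y : EuclideanSpace ℝ (Fin d),
    Complex.exp (-(2 * Real.pi * Complex.I * (inner ℝ y (sndHalf z) : ℝ))) *
      f (matAct A.toBlocks₁₁ (fstHalf z) + matAct A.toBlocks₁₂ y) *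
      conj (g (matAct A.toBlocks₂₁ (fstHalf z) + matAct A.toBlocks₂₂ y))

/-- A block matrix is left-regular if the blocks `A₁₁` and `A₂₁` are invertible. -/
def IsBlockLeftRegular {d : ℕ} (A : Matrix (Fin d ⊕ Fin d) (Fin d ⊕ Fin d) ℝ) : Prop :=
  IsUnit A.toBlocks₁₁ ∧ IsUnit A.toBlocks₂₁

/-- The inverse transpose `A^# = (A⁻¹)ᵀ`. -/
def sharp {d : ℕ} (A : Matrix (Fin d ⊕ Fin d) (Fin d ⊕ Fin d) ℝ) :
    Matrix (Fin d ⊕ Fin d) (Fin d ⊕ Fin d) ℝ :=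
  (A⁻¹)ᵀ

/-- The relation `u = σ^A f` for a Schwartz function `f`: for every Schwartz function `h`,
the function `B_A(h, f)` is a Schwartz function on `ℝ^{2d}` and `⟨u, h⟩ = ⟨σ, B_A(h, f)⟩`. -/
def IsMatrixOp {d : ℕ} (A : Matrix (Fin d ⊕ Fin d) (Fin d ⊕ Fin d) ℝ)
    (σ : 𝓢'(EuclideanSpace ℝ (Fin d ⊕ Fin d), ℂ)) (f : 𝓢(EuclideanSpace ℝ (Fin d), ℂ))
    (u : 𝓢'(EuclideanSpace ℝ (Fin d), ℂ)) : Prop :=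
  ∀ h : 𝓢(EuclideanSpace ℝ (Fin d), ℂ), ∃ Φ : 𝓢(EuclideanSpace ℝ (Fin d ⊕ Fin d), ℂ),
    (∀ z, Φ z = matrixWigner A h f z) ∧ bracket u h = bracket σ Φ

/-- `T` is the pseudodifferential operator `σ^A`, extended from the Schwartz space to
`M^∞ = M^{∞,∞}`, the largest of the modulation spaces: on `M^∞` it is linear and continuous
for weak-* convergence (convergence as tempered distributions along sequences bounded in `M^∞`),
and on Schwartz functions it is `σ^A`. As every element of `M^∞` is the weak-* limit of a
sequence of Schwartz functions, this determines `T` on `M^∞`. Values of `T` outside `M^∞` are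
irrelevant. -/
structure IsExtendedMatrixOp {d : ℕ} (g : 𝓢(EuclideanSpace ℝ (Fin d), ℂ))
    (A : Matrix (Fin d ⊕ Fin d) (Fin d ⊕ Fin d) ℝ)
    (σ : 𝓢'(EuclideanSpace ℝ (Fin d ⊕ Fin d), ℂ))
    (T : 𝓢'(EuclideanSpace ℝ (Fin d), ℂ) → 𝓢'(EuclideanSpace ℝ (Fin d), ℂ)) : Prop where
  map_add : ∀ u ∈ modSpace g ∞ ∞, ∀ v ∈ modSpace g ∞ ∞, T (u + v) = T u + T v
  map_smul : ∀ c : ℂ, ∀ u ∈ modSpace g ∞ ∞, T (c • u) = c • T u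
  apply_schwartz : ∀ f : 𝓢(EuclideanSpace ℝ (Fin d), ℂ),
    IsMatrixOp A σ f
      (T (SchwartzMap.toTemperedDistributionCLM (EuclideanSpace ℝ (Fin d)) ℂ volume f))
  tendsto : ∀ (u : ℕ → 𝓢'(EuclideanSpace ℝ (Fin d), ℂ)) (v : 𝓢'(EuclideanSpace ℝ (Fin d), ℂ)),
    (∃ R : ℝ≥0, ∀ n, modNorm g ∞ ∞ (u n) ≤ R) →
    (∀ φ : 𝓢(EuclideanSpace ℝ (Fin d), ℂ), Tendsto (fun n => u n φ) atTop (𝓝 (v φ))) →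
    ∀ φ : 𝓢(EuclideanSpace ℝ (Fin d), ℂ), Tendsto (fun n => T (u n) φ) atTop (𝓝 (T v φ))

end

end MatrixWigner

namespace MatrixWigner

noncomputable section

/-! ### Tensor products and slices of Schwartz functions -/

section Tensor

variable {V W : Type} [NormedAddCommGroup V] [NormedSpace ℝ V]
  [NormedAddCommGroup W] [NormedSpace ℝ W]

/-! The proof reads `σ^A` off its Gabor matrix. The matrix-Wigner distribution is covariant
(`wignerS_tfShift`): `B_A(π(w)g, π(z)g)` is, up to a unimodular constant, a time-frequency shift of
the fixed Schwartz function `B_A(g, g)`. Hence `|⟨σ^A π(z)g, π(w)g⟩|` is the modulus of the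
short-time Fourier transform of `σ` with window `B_A(g, g)` at a point `(X, Ω)` depending linearly
on `(w, z)`. For `σ` in the Sjöstrand class this is at most `H(Ω)` with `H` integrable, whatever `X`
is (`exists_majorant_stft`).

One half of `Ω` combines only the two frequencies, through the transposes of `A₁₁` and `A₂₁`; the
other combines only the two positions, through the lower blocks of `A⁻¹`. Left-regularity makes all
four blocks invertible (`isUnit_inv_blocks`). So the majorant is a convolution kernel up to linear
changes of variables that do not mix position and frequency, and Minkowski's inequality bounds it on
every mixed-norm space with a constant independent of `p` and `q` (`exists_mixedNorm_lintegral_le`).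

The extension to `M^∞` is defined by `⟨Tu, h⟩ = ‖g‖⁻² ∫ V_g u(z) ⟨σ, B_A(h, π(z)g)⟩ dz`. The
coefficients are integrable in `z`, so this converges for bounded `V_g u`, and weak-* continuity is
dominated convergence. Agreement with `σ^A` on Schwartz functions, and the passage from matrix
coefficients to arbitrary test functions, rest on the inversion formula
`isSchwartzIntegral_synthesis`, in a form strong enough for any tempered distribution to be applied
under the integral (`IsSchwartzIntegral.map_eq_integral`).

The determinant factors cost nothing: their exponents lie in `[0, 1]`, so for fixed `A` their
product is bounded below uniformly in `p` and `q`, and a constant depending on `A` absorbs it. -/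

theorem norm_iteratedFDeriv_comp_fst_le (f : 𝓢(V, ℂ)) (n : ℕ) (z : V × W) :
    ‖iteratedFDeriv ℝ n (fun z : V × W => f z.1) z‖ ≤ ‖iteratedFDeriv ℝ n f z.1‖ := by
  have h := (ContinuousLinearMap.fst ℝ V W).iteratedFDeriv_comp_right (f.smooth ⊤) z
    (i := n) (by exact_mod_cast le_top)
  have h' : (f ∘ (ContinuousLinearMap.fst ℝ V W)) = fun z : V × W => f z.1 := rfl
  rw [h'] at h
  rw [h]
  refine (ContinuousMultilinearMap.norm_compContinuousLinearMap_le _ _).trans ?_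
  refine mul_le_of_le_one_right (norm_nonneg _) ?_
  exact Finset.prod_le_one (fun _ _ => norm_nonneg _)
    fun _ _ => ContinuousLinearMap.norm_fst_le ℝ V W

theorem norm_iteratedFDeriv_comp_snd_le (f : 𝓢(W, ℂ)) (n : ℕ) (z : V × W) :
    ‖iteratedFDeriv ℝ n (fun z : V × W => f z.2) z‖ ≤ ‖iteratedFDeriv ℝ n f z.2‖ := by
  have h := (ContinuousLinearMap.snd ℝ V W).iteratedFDeriv_comp_right (f.smooth ⊤) z
    (i := n) (by exact_mod_cast le_top)
  have h' : (f ∘ (ContinuousLinearMap.snd ℝ V W)) = fun z : V × W => f z.2 := rfl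
  rw [h'] at h
  rw [h]
  refine (ContinuousMultilinearMap.norm_compContinuousLinearMap_le _ _).trans ?_
  refine mul_le_of_le_one_right (norm_nonneg _) ?_
  exact Finset.prod_le_one (fun _ _ => norm_nonneg _)
    fun _ _ => ContinuousLinearMap.norm_snd_le ℝ V W

/-- Leibniz' rule. The maximum norm gives `‖z‖ ≤ (1 + ‖z.1‖)(1 + ‖z.2‖)`, so the weight splits
between the factors; the binomial coefficients sum to `2 ^ n`. With `χ` fixed, this is the
continuity estimate for `tensorRight`. -/
theorem norm_iteratedFDeriv_tensor_le (f : 𝓢(V, ℂ)) (χ : 𝓢(W, ℂ)) (k n : ℕ) (z : V × W) :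
    ‖z‖ ^ k * ‖iteratedFDeriv ℝ n (fun z : V × W => f z.1 * χ z.2) z‖ ≤
      (2 ^ n * 2 ^ k * 2 ^ k *
        (Finset.Iic (k, n)).sup (fun m => SchwartzMap.seminorm ℂ m.1 m.2) χ) *
        (Finset.Iic (k, n)).sup (schwartzSeminormFamily ℂ V ℂ) f := by
  have hf : ContDiff ℝ ((⊤ : ℕ∞) : WithTop ℕ∞) (fun z : V × W => f z.1) := (f.smooth ⊤).comp contDiff_fst
  have hχ : ContDiff ℝ ((⊤ : ℕ∞) : WithTop ℕ∞) (fun z : V × W => χ z.2) := (χ.smooth ⊤).comp contDiff_snd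
  have h1 := norm_iteratedFDeriv_mul_le hf hχ z (n := n) (by exact_mod_cast le_top)
  set Sf := (Finset.Iic (k, n)).sup (schwartzSeminormFamily ℂ V ℂ) f with hSf
  set Sχ := (Finset.Iic (k, n)).sup (fun m => SchwartzMap.seminorm ℂ m.1 m.2) χ with hSχ
  have hz : ‖z‖ ^ k ≤ (1 + ‖z.1‖) ^ k * (1 + ‖z.2‖) ^ k := by
    rw [← mul_pow]
    refine pow_le_pow_left₀ (norm_nonneg _) ?_ _
    rw [Prod.norm_def]
    refine max_le ?_ ?_ <;> nlinarith [norm_nonneg z.1, norm_nonneg z.2]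
  have hterm : ∀ i ∈ Finset.range (n + 1),
      (n.choose i : ℝ) * ‖iteratedFDeriv ℝ i (fun z : V × W => f z.1) z‖ *
        ‖iteratedFDeriv ℝ (n - i) (fun z : V × W => χ z.2) z‖ *
        ((1 + ‖z.1‖) ^ k * (1 + ‖z.2‖) ^ k) ≤
      (n.choose i : ℝ) * ((2 ^ k * Sf) * (2 ^ k * Sχ)) := by
    intro i hi
    have hi' : i ≤ n := by simpa [Nat.lt_succ_iff] using hi
    have a := SchwartzMap.one_add_le_sup_seminorm_apply (𝕜 := ℂ) (m := (k, n)) le_rfl hi' f z.1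
    have b := SchwartzMap.one_add_le_sup_seminorm_apply (𝕜 := ℂ) (m := (k, n)) le_rfl
      (Nat.sub_le n i) χ z.2
    have a' := mul_le_mul_of_nonneg_left (norm_iteratedFDeriv_comp_fst_le (W := W) f i z)
      (by positivity : 0 ≤ (1 + ‖z.1‖) ^ k)
    have b' := mul_le_mul_of_nonneg_left (norm_iteratedFDeriv_comp_snd_le (V := V) χ (n - i) z)
      (by positivity : 0 ≤ (1 + ‖z.2‖) ^ k)
    calc _ = (n.choose i : ℝ) *
          (((1 + ‖z.1‖) ^ k * ‖iteratedFDeriv ℝ i (fun z : V × W => f z.1) z‖) *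
          ((1 + ‖z.2‖) ^ k * ‖iteratedFDeriv ℝ (n - i) (fun z : V × W => χ z.2) z‖)) := by ring
      _ ≤ _ := by
        refine mul_le_mul_of_nonneg_left ?_ (Nat.cast_nonneg _)
        exact mul_le_mul (a'.trans a) (b'.trans b) (by positivity)
          (le_trans (by positivity) (a'.trans a))
  calc _ ≤ ((1 + ‖z.1‖) ^ k * (1 + ‖z.2‖) ^ k) *
        ∑ i ∈ Finset.range (n + 1), (n.choose i : ℝ) *
          ‖iteratedFDeriv ℝ i (fun z : V × W => f z.1) z‖ *
          ‖iteratedFDeriv ℝ (n - i) (fun z : V × W => χ z.2) z‖ := by gcongr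
    _ ≤ ∑ i ∈ Finset.range (n + 1), (n.choose i : ℝ) * ((2 ^ k * Sf) * (2 ^ k * Sχ)) := by
        rw [mul_comm, Finset.sum_mul]
        exact Finset.sum_le_sum hterm
    _ = _ := by
        rw [← Finset.sum_mul]
        have : ∑ i ∈ Finset.range (n + 1), (n.choose i : ℝ) = 2 ^ n := by
          exact_mod_cast Nat.sum_range_choose n
        rw [this]; ring

/-- The tensor product `(x, y) ↦ f x * χ y` with a fixed Schwartz function `χ`. -/
def tensorRight (χ : 𝓢(W, ℂ)) : 𝓢(V, ℂ) →L[ℂ] 𝓢(V × W, ℂ) :=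
  SchwartzMap.mkCLM (fun f z => f z.1 * χ z.2) (fun f g z => by simp [add_mul])
    (fun a f z => by simp [mul_assoc])
    (fun f => ((f.smooth ⊤).comp contDiff_fst).mul ((χ.smooth ⊤).comp contDiff_snd))
    (fun n => ⟨Finset.Iic n, _, by positivity,
      fun f z => norm_iteratedFDeriv_tensor_le f χ n.1 n.2 z⟩)

@[simp]
theorem tensorRight_apply (χ : 𝓢(W, ℂ)) (f : 𝓢(V, ℂ)) (z : V × W) :
    tensorRight χ f z = f z.1 * χ z.2 := rfl

/-- The tensor product `(x, y) ↦ f x * χ y` with a fixed Schwartz function `f`. -/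
def tensorLeft (f : 𝓢(V, ℂ)) : 𝓢(W, ℂ) →L[ℂ] 𝓢(V × W, ℂ) :=
  (SchwartzMap.compCLMOfContinuousLinearEquiv ℂ (ContinuousLinearEquiv.prodComm ℝ V W)).comp
    (tensorRight f)

@[simp]
theorem tensorLeft_apply (f : 𝓢(V, ℂ)) (χ : 𝓢(W, ℂ)) (z : V × W) :
    tensorLeft f χ z = f z.1 * χ z.2 := by
  simp [tensorLeft, mul_comm]

end Tensor

section Slice

variable {V W F : Type} [NormedAddCommGroup V] [NormedSpace ℝ V]
  [NormedAddCommGroup W] [NormedSpace ℝ W] [NormedAddCommGroup F] [NormedSpace ℝ F]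

theorem hasTemperateGrowth_prodMk_right (s : W) :
    (fun x : V => (x, s)).HasTemperateGrowth := by
  have : (fun x : V => (x, s)) =
      (fun x => ContinuousLinearMap.inl ℝ V W x) + fun _ => ((0, s) : V × W) := by
    ext x <;> simp
  rw [this]
  exact (ContinuousLinearMap.hasTemperateGrowth _).add (.const _)

/-- The slice `x ↦ Θ (x, s)` of a Schwartz function on a product. -/
def slice (s : W) : 𝓢(V × W, F) →L[ℝ] 𝓢(V, F) :=
  SchwartzMap.compCLM ℝ (hasTemperateGrowth_prodMk_right s)
    ⟨1, 1, fun x => by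
      have : ‖x‖ ≤ ‖(x, s)‖ := by rw [Prod.norm_def]; exact le_max_left _ _
      simp only [pow_one, one_mul]
      linarith⟩

@[simp]
theorem slice_apply (s : W) (Θ : 𝓢(V × W, F)) (x : V) : slice s Θ x = Θ (x, s) := rfl

theorem iteratedFDeriv_slice (s : W) (Θ : 𝓢(V × W, F)) (n : ℕ) (x : V) :
    iteratedFDeriv ℝ n (slice s Θ) x =
      (iteratedFDeriv ℝ n Θ (x, s)).compContinuousLinearMap
        fun _ => ContinuousLinearMap.inl ℝ V W := by
  have h0 : (slice s Θ : V → F) =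
      (fun z => Θ (z + (0, s))) ∘ (ContinuousLinearMap.inl ℝ V W) := by
    ext x; simp
  have h1 : ContDiff ℝ ((⊤ : ℕ∞) : WithTop ℕ∞) (fun z => Θ (z + (0, s))) :=
    (Θ.smooth ⊤).comp (contDiff_id.add contDiff_const)
  rw [h0, (ContinuousLinearMap.inl ℝ V W).iteratedFDeriv_comp_right h1 x
    (by exact_mod_cast le_top), iteratedFDeriv_comp_add_right]
  simp

theorem norm_compContinuousLinearMap_inl_le {n : ℕ} (M : (V × W) [×n]→L[ℝ] F) :
    ‖M.compContinuousLinearMap fun _ => ContinuousLinearMap.inl ℝ V W‖ ≤ ‖M‖ := by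
  refine (ContinuousMultilinearMap.norm_compContinuousLinearMap_le _ _).trans ?_
  refine mul_le_of_le_one_right (norm_nonneg _) ?_
  exact Finset.prod_le_one (fun _ _ => norm_nonneg _)
    fun _ _ => ContinuousLinearMap.norm_inl_le_one ℝ V W

/-- The weight in `s` is paid for by `m` additional powers of the weight in the seminorms of `Θ`.
Slices therefore decay faster than any power of `s`, which makes their seminorms integrable in `s`.
-/
theorem seminorm_slice_le (k n m : ℕ) (s : W) (Θ : 𝓢(V × W, F)) :
    (1 + ‖s‖) ^ m * SchwartzMap.seminorm ℝ k n (slice s Θ) ≤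
      2 ^ (k + m) * (Finset.Iic (k + m, n)).sup
        (fun m => SchwartzMap.seminorm ℝ m.1 m.2) Θ := by
  have hs : 0 < (1 + ‖s‖) ^ m := by positivity
  rw [mul_comm, ← le_div_iff₀ hs]
  refine SchwartzMap.seminorm_le_bound _ _ _ _ (by positivity) fun x => ?_
  rw [le_div_iff₀ hs, iteratedFDeriv_slice]
  refine le_trans ?_ (SchwartzMap.one_add_le_sup_seminorm_apply (𝕜 := ℝ) (m := (k + m, n)) le_rfl
    le_rfl Θ (x, s))
  have hx : ‖x‖ ≤ 1 + ‖(x, s)‖ := by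
    rw [Prod.norm_def]; exact (le_max_left _ _).trans (by linarith)
  have hs' : 1 + ‖s‖ ≤ 1 + ‖(x, s)‖ := by
    rw [Prod.norm_def]; gcongr; exact le_max_right _ _
  calc _ = ‖x‖ ^ k * (1 + ‖s‖) ^ m * ‖(iteratedFDeriv ℝ n Θ (x, s)).compContinuousLinearMap
        fun _ => ContinuousLinearMap.inl ℝ V W‖ := by ring
    _ ≤ (1 + ‖(x, s)‖) ^ k * (1 + ‖(x, s)‖) ^ m * ‖iteratedFDeriv ℝ n Θ (x, s)‖ := by
        gcongr
        exact norm_compContinuousLinearMap_inl_le _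
    _ = _ := by rw [pow_add]

/-- Mean value inequality in the direction of `W`: one more derivative of `Θ` buys a Lipschitz bound
in the parameter, and hence the continuity of `s ↦ slice s Θ`. -/
theorem seminorm_slice_sub_le (k n : ℕ) (s s₀ : W) (Θ : 𝓢(V × W, F)) :
    SchwartzMap.seminorm ℝ k n (slice s Θ - slice s₀ Θ) ≤
      SchwartzMap.seminorm ℝ k (n + 1) Θ * ‖s - s₀‖ := by
  refine SchwartzMap.seminorm_le_bound _ _ _ _ (by positivity) fun x => ?_
  have hsub : iteratedFDeriv ℝ n (slice s Θ - slice s₀ Θ) x =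
      iteratedFDeriv ℝ n (slice s Θ) x - iteratedFDeriv ℝ n (slice s₀ Θ) x := by
    have := iteratedFDeriv_sub_apply (𝕜 := ℝ) (i := n) (x := x)
      (f := slice s Θ) (g := slice s₀ Θ)
      ((slice s Θ).contDiffAt n) ((slice s₀ Θ).contDiffAt n)
    exact this
  rw [hsub, iteratedFDeriv_slice, iteratedFDeriv_slice]
  have hlin : (iteratedFDeriv ℝ n Θ (x, s)).compContinuousLinearMap
        (fun _ => ContinuousLinearMap.inl ℝ V W) -
      (iteratedFDeriv ℝ n Θ (x, s₀)).compContinuousLinearMap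
        (fun _ => ContinuousLinearMap.inl ℝ V W) =
      (iteratedFDeriv ℝ n Θ (x, s) - iteratedFDeriv ℝ n Θ (x, s₀)).compContinuousLinearMap
        (fun _ => ContinuousLinearMap.inl ℝ V W) := by
    ext v; simp
  rw [hlin]
  grw [norm_compContinuousLinearMap_inl_le]
  rcases eq_or_ne (‖x‖ ^ k) 0 with h0 | h0
  · rw [h0, zero_mul]; positivity
  have hpos : 0 < ‖x‖ ^ k := lt_of_le_of_ne (by positivity) (Ne.symm h0)
  have hdiff : Differentiable ℝ (iteratedFDeriv ℝ n Θ) :=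
    (Θ.smooth ⊤).differentiable_iteratedFDeriv (by exact_mod_cast ENat.natCast_lt_top n)
  -- With `x` fixed and `‖x‖ ^ k` positive, dividing the seminorm by this weight bounds the
  -- derivative uniformly along `{x} × W`.
  have key := (convex_univ (𝕜 := ℝ) (E := W)).norm_image_sub_le_of_norm_hasFDerivWithin_le
    (f := fun s => iteratedFDeriv ℝ n Θ (x, s))
    (f' := fun s => (fderiv ℝ (iteratedFDeriv ℝ n Θ) (x, s)).comp (ContinuousLinearMap.inr ℝ V W))
    (C := SchwartzMap.seminorm ℝ k (n + 1) Θ / ‖x‖ ^ k)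
    (x := s₀) (y := s)
    (fun s _ => by
      have h1 := (hdiff (x, s)).hasFDerivAt
      have h2 : HasFDerivAt (fun s : W => (x, s)) (ContinuousLinearMap.inr ℝ V W) s :=
        hasFDerivAt_prodMk_right x s
      exact (h1.comp s h2).hasFDerivWithinAt)
    (fun s _ => by
      refine (ContinuousLinearMap.opNorm_comp_le _ _).trans ?_
      rw [norm_fderiv_iteratedFDeriv]
      refine (mul_le_of_le_one_right (norm_nonneg _)
        (ContinuousLinearMap.norm_inr_le_one ℝ V W)).trans ?_
      rw [le_div_iff₀ hpos, mul_comm]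
      refine le_trans ?_ (SchwartzMap.le_seminorm ℝ k (n + 1) Θ (x, s))
      gcongr
      rw [Prod.norm_def]; exact le_max_left _ _) trivial trivial
  calc _ ≤ ‖x‖ ^ k * (SchwartzMap.seminorm ℝ k (n + 1) Θ / ‖x‖ ^ k * ‖s - s₀‖) := by
        gcongr
    _ = _ := by field_simp

theorem continuous_slice (Θ : 𝓢(V × W, F)) : Continuous fun s => slice s Θ := by
  rw [continuous_iff_continuousAt]
  intro s₀
  refine ((schwartz_withSeminorms ℝ V F).tendsto_nhds _ _).2 fun ⟨k, n⟩ ε hε => ?_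
  have hlim : Tendsto (fun s => SchwartzMap.seminorm ℝ k (n + 1) Θ * ‖s - s₀‖) (𝓝 s₀) (𝓝 0) := by
    have : Continuous fun s : W => SchwartzMap.seminorm ℝ k (n + 1) Θ * ‖s - s₀‖ := by fun_prop
    simpa using this.tendsto s₀
  filter_upwards [hlim.eventually (gt_mem_nhds hε)] with s hs
  exact (seminorm_slice_sub_le k n s s₀ Θ).trans_lt hs

end Slice

set_option linter.unusedSectionVars false

/-! ### The partial Fourier transform -/

section SeminormBound

variable {X F : Type} [NormedAddCommGroup X] [NormedSpace ℝ X]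
  [NormedAddCommGroup F] [NormedSpace ℝ F]

/-- A family of functionals on the Schwartz space is dominated by one continuous seminorm. -/
def SeminormBounded {ι : Sort*} (B : 𝓢(X, F) → ι → ℝ) : Prop :=
  ∃ q : Seminorm ℝ 𝓢(X, F), Continuous q ∧ ∀ Ψ i, B Ψ i ≤ q Ψ

namespace SeminormBounded

variable {ι : Sort*}

theorem mono {B B' : 𝓢(X, F) → ι → ℝ} (h : SeminormBounded B)
    (hB : ∀ Ψ i, B' Ψ i ≤ B Ψ i) : SeminormBounded B' := by
  obtain ⟨q, hq, h⟩ := h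
  exact ⟨q, hq, fun Ψ i => (hB Ψ i).trans (h Ψ i)⟩

theorem add {B B' : 𝓢(X, F) → ι → ℝ} (h : SeminormBounded B) (h' : SeminormBounded B') :
    SeminormBounded fun Ψ i => B Ψ i + B' Ψ i := by
  obtain ⟨q, hq, h⟩ := h
  obtain ⟨q', hq', h'⟩ := h'
  exact ⟨q + q', hq.add hq', fun Ψ i => add_le_add (h Ψ i) (h' Ψ i)⟩

theorem const_mul {B : 𝓢(X, F) → ι → ℝ} (h : SeminormBounded B) {c : ℝ} (hc : 0 ≤ c) :
    SeminormBounded fun Ψ i => c * B Ψ i := by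
  obtain ⟨q, hq, h⟩ := h
  exact ⟨c.toNNReal • q, hq.const_smul c.toNNReal,
    fun Ψ i => by
      change c * B Ψ i ≤ (c.toNNReal : ℝ) * q Ψ
      rw [Real.coe_toNNReal c hc]
      exact mul_le_mul_of_nonneg_left (h Ψ i) hc⟩

theorem zero : SeminormBounded fun (_ : 𝓢(X, F)) (_ : ι) => (0 : ℝ) :=
  ⟨0, continuous_const, fun _ _ => le_rfl⟩

theorem sum {κ : Type*} (S : Finset κ) {B : κ → 𝓢(X, F) → ι → ℝ}
    (h : ∀ k, SeminormBounded (B k)) : SeminormBounded fun Ψ i => ∑ k ∈ S, B k Ψ i := by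
  classical
  induction S using Finset.induction_on with
  | empty => simpa using zero
  | insert a S ha ih =>
    simp only [Finset.sum_insert ha]
    exact (h a).add ih

theorem comp {Y G : Type} [NormedAddCommGroup Y] [NormedSpace ℝ Y]
    [NormedAddCommGroup G] [NormedSpace ℝ G] {B : 𝓢(X, F) → ι → ℝ} (h : SeminormBounded B)
    (T : 𝓢(Y, G) →L[ℝ] 𝓢(X, F)) : SeminormBounded fun Ψ i => B (T Ψ) i := by
  obtain ⟨q, hq, h⟩ := h
  exact ⟨q.comp T.toLinearMap, hq.comp T.continuous, fun Ψ i => h (T Ψ) i⟩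

theorem seminorm (k n : ℕ) :
    SeminormBounded fun (Ψ : 𝓢(X, F)) (_ : ι) => SchwartzMap.seminorm ℝ k n Ψ :=
  ⟨SchwartzMap.seminorm ℝ k n, (schwartz_withSeminorms ℝ X F).continuous_seminorm (k, n),
    fun _ _ => le_rfl⟩

theorem supSeminorm (m : ℕ × ℕ) :
    SeminormBounded fun (Ψ : 𝓢(X, F)) (_ : ι) =>
      (Finset.Iic m).sup (fun m => SchwartzMap.seminorm ℝ m.1 m.2) Ψ := by
  refine (sum (Finset.Iic m) fun m => seminorm m.1 m.2).mono fun Ψ i => ?_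
  refine Seminorm.finset_sup_apply_le (Finset.sum_nonneg fun _ _ => apply_nonneg _ _) fun j hj => ?_
  exact Finset.single_le_sum (f := fun j : ℕ × ℕ => SchwartzMap.seminorm ℝ j.1 j.2 Ψ)
    (fun _ _ => apply_nonneg _ _) hj

end SeminormBounded

end SeminormBound

section PartialFourier

open scoped FourierTransform RealInnerProductSpace

variable {W V F : Type} [NormedAddCommGroup W] [InnerProductSpace ℝ W] [FiniteDimensional ℝ W]
  [MeasurableSpace W] [BorelSpace W] [NormedAddCommGroup V] [NormedSpace ℝ V]
  [NormedAddCommGroup F] [NormedSpace ℝ F] [NormedSpace ℂ F] [IsScalarTower ℝ ℂ F]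

/-- The Fourier transform of `Ψ` in the first variable, as a function. -/
def partialFourierFun (Ψ : 𝓢(W × V, F)) (z : W × V) : F :=
  ∫ y, Real.fourierChar (-⟪y, z.1⟫) • Ψ (y, z.2)

/-- The Fourier estimates use the real structure induced by the complex one. Identifying the two
makes the estimates available for operator-valued targets, whose real structure arises differently.
-/
theorem normedSpace_real_eq_complexToReal {F : Type} [NormedAddCommGroup F] (i : NormedSpace ℝ F)
    [NormedSpace ℂ F] [IsScalarTower ℝ ℂ F] : i = NormedSpace.complexToReal := by
  refine NormedSpace.ext ?_
  ext r x
  exact (algebraMap_smul ℂ r x).symm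

theorem seminormBounded_integral_slice (m a b : ℕ) :
    SeminormBounded fun (Ψ : 𝓢(W × V, F)) (x : V) =>
      (1 + ‖x‖) ^ m * ∫ y, ‖y‖ ^ a * ‖iteratedFDeriv ℝ b (slice x Ψ) y‖ := by
  set N := (volume : Measure W).integrablePower
  set I := ∫ x : W, (1 + ‖x‖) ^ (- (N : ℝ))
  have hI : 0 ≤ I := integral_nonneg fun x => by positivity
  have h1 : ∀ k, SeminormBounded fun (Ψ : 𝓢(W × V, F)) (x : V) =>
      (1 + ‖x‖) ^ m * SchwartzMap.seminorm ℝ k b (slice x Ψ) := fun k =>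
    ((SeminormBounded.supSeminorm (k + m, b)).const_mul (by positivity)).mono
      fun Ψ x => seminorm_slice_le k b m x Ψ
  refine (((h1 0).add (h1 (a + N))).const_mul
    (mul_nonneg (by positivity) hI : 0 ≤ 2 ^ N * I)).mono fun Ψ x => ?_
  have := SchwartzMap.integral_pow_mul_iteratedFDeriv_le ℝ (volume : Measure W) (slice x Ψ) a b
  calc _ ≤ (1 + ‖x‖) ^ m * (2 ^ N * I * (SchwartzMap.seminorm ℝ 0 b (slice x Ψ) +
        SchwartzMap.seminorm ℝ (a + N) b (slice x Ψ))) := by gcongr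
    _ = _ := by ring

/-- Powers of the frequency become derivatives of the slice under the Fourier transform, while the
second variable is a mere parameter whose weight `seminormBounded_integral_slice` absorbs. -/
theorem seminormBounded_partialFourierFun (m n : ℕ) :
    SeminormBounded fun (Ψ : 𝓢(W × V, F)) (z : W × V) =>
      (1 + ‖z.2‖) ^ m * (‖z.1‖ ^ n * ‖partialFourierFun Ψ z‖) := by
  have h1 : SeminormBounded fun (Ψ : 𝓢(W × V, F)) (z : W × V) =>
      ∑ p ∈ Finset.range (0 + 1) ×ˢ Finset.range (n + 1),
        (1 + ‖z.2‖) ^ m * ∫ y, ‖y‖ ^ p.1 * ‖iteratedFDeriv ℝ p.2 (slice z.2 Ψ) y‖ := by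
    refine SeminormBounded.sum _ fun p => ?_
    obtain ⟨q, hq, h⟩ := seminormBounded_integral_slice (W := W) (V := V) (F := F) m p.1 p.2
    exact ⟨q, hq, fun Ψ z => h Ψ z.2⟩
  refine (h1.const_mul (by positivity : (0 : ℝ) ≤ 2 ^ n)).mono fun Ψ z => ?_
  obtain rfl := normedSpace_real_eq_complexToReal (F := F) inferInstance
  have := Real.pow_mul_norm_iteratedFDeriv_fourier_le (K := ⊤) (N := ⊤)
    ((slice z.2 Ψ).smooth ⊤) (fun k n _ _ =>
      SchwartzMap.integrable_pow_mul_iteratedFDeriv _ (slice z.2 Ψ) k n)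
    (k := 0) (n := n) le_top le_top z.1
  rw [norm_iteratedFDeriv_zero] at this
  simp only [CharP.cast_eq_zero, pow_zero, mul_zero, zero_add, one_mul] at this
  rw [← Finset.mul_sum, mul_left_comm (2 ^ n : ℝ)]
  refine mul_le_mul_of_nonneg_left ?_ (by positivity)
  simpa [partialFourierFun, Real.fourier_eq] using this

variable (W V F) in
/-- The operator on Schwartz functions that corresponds to the derivative of the partial
Fourier transform. -/
def partialFourierDeriv : 𝓢(W × V, F) →L[ℝ] 𝓢(W × V, W × V →L[ℝ] F) :=
  (SchwartzMap.postcompCLM (𝕜 := ℝ) (((ContinuousLinearMap.compL ℝ (W × V) (W × V) F).flip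
      ((ContinuousLinearMap.inr ℝ W V).comp (ContinuousLinearMap.snd ℝ W V))))).comp
    (SchwartzMap.fderivCLM ℝ (W × V) F) +
  (SchwartzMap.postcompCLM (𝕜 := ℝ)
    (((-(2 * Real.pi * Complex.I) : ℂ) •
      (ContinuousLinearMap.id ℂ (W × V →L[ℝ] F))).restrictScalars ℝ)).comp
    (SchwartzMap.smulRightCLM ℝ F
      ((innerSL ℝ : W →L[ℝ] W →L[ℝ] ℝ).bilinearComp (ContinuousLinearMap.fst ℝ W V)
        (ContinuousLinearMap.fst ℝ W V)))

theorem partialFourierDeriv_apply (Ψ : 𝓢(W × V, F)) (z v : W × V) :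
    partialFourierDeriv W V F Ψ z v =
      fderiv ℝ Ψ z (0, v.2) + (-(2 * Real.pi * Complex.I) : ℂ) • ⟪z.1, v.1⟫ • Ψ z := by
  simp [partialFourierDeriv]

theorem integrable_fourierChar_smul_slice (Ψ : 𝓢(W × V, F)) (z : W × V) :
    Integrable fun y => Real.fourierChar (-⟪y, z.1⟫) • Ψ (y, z.2) := by
  have := (slice z.2 Ψ).integrable (μ := (volume : Measure W))
  exact (Real.fourierIntegral_convergent_iff z.1).2 this

theorem exists_norm_apply_le_of_prod (Ψ : 𝓢(W × V, F)) (N : ℕ) :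
    ∃ C : ℝ, ∀ z, ‖Ψ z‖ ≤ C * (1 + ‖z.1‖) ^ (-(N : ℝ)) := by
  refine ⟨2 ^ N * (Finset.Iic (N, 0)).sup (fun m => SchwartzMap.seminorm ℝ m.1 m.2) Ψ,
    fun z => ?_⟩
  rw [Real.rpow_neg (by positivity), Real.rpow_natCast, ← div_eq_mul_inv,
    le_div_iff₀ (by positivity), mul_comm]
  have := SchwartzMap.one_add_le_sup_seminorm_apply (𝕜 := ℝ) (m := (N, 0)) le_rfl le_rfl Ψ z
  rw [norm_iteratedFDeriv_zero] at this
  refine le_trans ?_ this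
  gcongr
  rw [Prod.norm_def]; exact le_max_left _ _

theorem hasFDerivAt_fourierChar_smul_slice (Ψ : 𝓢(W × V, F)) (y : W) (z : W × V) :
    HasFDerivAt (fun z : W × V => Real.fourierChar (-⟪y, z.1⟫) • Ψ (y, z.2))
      (Real.fourierChar (-⟪y, z.1⟫) • partialFourierDeriv W V F Ψ (y, z.2)) z := by
  have h1 : HasFDerivAt (fun z : W × V => (Real.fourierChar (-⟪y, z.1⟫) : ℂ)) _ z :=
    (Real.hasFDerivAt_fourierChar_neg_bilinear_right (innerSL ℝ) y z.1).comp z hasFDerivAt_fst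
  have h2 : HasFDerivAt (fun z : W × V => Ψ (y, z.2)) _ z :=
    (Ψ.hasFDerivAt (y, z.2)).comp z
      ((hasFDerivAt_prodMk_right y z.2).comp z hasFDerivAt_snd)
  refine (h1.smul h2).congr_fderiv (ContinuousLinearMap.ext fun v => ?_)
  change (Real.fourierChar (-⟪y, z.1⟫) : ℂ) • fderiv ℝ Ψ (y, z.2) (0, v.2) +
    (-2 * Real.pi * Complex.I * (Real.fourierChar (-⟪y, z.1⟫) : ℂ) * ((⟪y, v.1⟫ : ℝ) : ℂ)) •
      Ψ (y, z.2) = (Real.fourierChar (-⟪y, z.1⟫) : ℂ) • partialFourierDeriv W V F Ψ (y, z.2) v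
  rw [partialFourierDeriv_apply, ← algebraMap_smul ℂ (⟪y, v.1⟫ : ℝ), smul_add, smul_smul, smul_smul]
  congr 2
  simp only [Complex.coe_algebraMap]
  ring

/-- Differentiation under the integral. The derivative is again a partial Fourier transform, of a
Schwartz function with values in a larger space, so smoothness and decay follow by induction on the
order. -/
theorem hasFDerivAt_partialFourierFun (Ψ : 𝓢(W × V, F)) (z : W × V) :
    HasFDerivAt (partialFourierFun Ψ)
      (partialFourierFun (F := W × V →L[ℝ] F) (partialFourierDeriv W V F Ψ) z) z := by
  set N := (volume : Measure W).integrablePower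
  obtain ⟨C, hC⟩ := exists_norm_apply_le_of_prod (F := W × V →L[ℝ] F)
    (partialFourierDeriv W V F Ψ) N
  refine hasFDerivAt_integral_of_dominated_of_fderiv_le (𝕜 := ℝ)
    (F := fun (z : W × V) y => Real.fourierChar (-⟪y, z.1⟫) • Ψ (y, z.2))
    (F' := fun (z : W × V) y =>
      Real.fourierChar (-⟪y, z.1⟫) • partialFourierDeriv W V F Ψ (y, z.2))
    (bound := fun y => C * (1 + ‖y‖) ^ (-(N : ℝ))) univ_mem
    (Eventually.of_forall fun z => (integrable_fourierChar_smul_slice Ψ z).aestronglyMeasurable)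
    (integrable_fourierChar_smul_slice Ψ z)
    (integrable_fourierChar_smul_slice (F := W × V →L[ℝ] F)
      (partialFourierDeriv W V F Ψ) z).aestronglyMeasurable
    (Eventually.of_forall fun y z _ => ?_)
    (((volume : Measure W).integrable_pow_neg_integrablePower).const_mul _)
    (Eventually.of_forall fun y z _ => hasFDerivAt_fourierChar_smul_slice Ψ y z)
  rw [Circle.smul_def, norm_smul, Circle.norm_coe, one_mul]
  exact hC (y, z.2)

-- `F` is quantified inside the induction because each derivative replaces it by `W × V →L[ℝ] F`.
theorem contDiff_partialFourierFun (n : ℕ) : ∀ {F : Type} [NormedAddCommGroup F] [NormedSpace ℝ F] [NormedSpace ℂ F]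
    [IsScalarTower ℝ ℂ F]
    (Ψ : 𝓢(W × V, F)), ContDiff ℝ n (partialFourierFun Ψ) := by
  induction n with
  | zero =>
    intro F _ _ _ _ Ψ
    exact contDiff_zero.2 (continuous_iff_continuousAt.2
      fun z => (hasFDerivAt_partialFourierFun Ψ z).continuousAt)
  | succ n ih =>
    intro F _ _ _ _ Ψ
    rw [Nat.cast_succ, contDiff_succ_iff_hasFDerivAt]
    exact ⟨_, ih _, hasFDerivAt_partialFourierFun Ψ⟩

theorem seminormBounded_iteratedFDeriv_partialFourierFun (k n : ℕ) :
    ∀ {F : Type} [NormedAddCommGroup F] [NormedSpace ℝ F] [NormedSpace ℂ F]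
      [IsScalarTower ℝ ℂ F],
      SeminormBounded fun (Ψ : 𝓢(W × V, F)) (z : W × V) =>
        ‖z‖ ^ k * ‖iteratedFDeriv ℝ n (partialFourierFun Ψ) z‖ := by
  induction n with
  | zero =>
    intro F _ _ _ _
    -- `‖z‖ ^ k` is the larger of the frequency weight and the parameter weight, so it is controlled
    -- by the sum of the two extreme cases.
    refine ((seminormBounded_partialFourierFun (W := W) (V := V) (F := F) 0 k).add
      (seminormBounded_partialFourierFun k 0)).mono fun Ψ z => ?_
    rw [norm_iteratedFDeriv_zero]
    simp only [pow_zero, one_mul]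
    rw [← add_mul]
    gcongr
    rw [Prod.norm_def]
    rcases max_cases ‖z.1‖ ‖z.2‖ with h | h
    · rw [h.1]; exact le_add_of_nonneg_right (by positivity)
    · rw [h.1]
      refine le_add_of_nonneg_of_le (by positivity) ?_
      gcongr; linarith
  | succ n ih =>
    intro F _ _ _ _
    refine ((ih (F := W × V →L[ℝ] F)).comp (partialFourierDeriv W V F)).mono fun Ψ z => ?_
    have : fderiv ℝ (partialFourierFun Ψ) =
        partialFourierFun (F := W × V →L[ℝ] F) (partialFourierDeriv W V F Ψ) :=
      funext fun z => (hasFDerivAt_partialFourierFun Ψ z).fderiv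
    rw [← norm_iteratedFDeriv_fderiv, this]

theorem SeminormBounded.exists_finset {X F : Type} [NormedAddCommGroup X] [NormedSpace ℝ X]
    [NormedAddCommGroup F] [NormedSpace ℝ F] {ι : Sort*} {B : 𝓢(X, F) → ι → ℝ}
    (h : SeminormBounded B) : ∃ (s : Finset (ℕ × ℕ)) (C : ℝ), 0 ≤ C ∧ ∀ Ψ i,
      B Ψ i ≤ C * s.sup (schwartzSeminormFamily ℝ X F) Ψ := by
  obtain ⟨q, hq, h⟩ := h
  obtain ⟨s, C, -, hC⟩ := Seminorm.bound_of_continuous (schwartz_withSeminorms ℝ X F) q hq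
  exact ⟨s, C, C.2, fun Ψ i => (h Ψ i).trans (hC Ψ)⟩

theorem partialFourierFun_add (f g : 𝓢(W × V, F)) (z : W × V) :
    partialFourierFun (f + g) z = partialFourierFun f z + partialFourierFun g z := by
  simp only [partialFourierFun]
  rw [← integral_add (integrable_fourierChar_smul_slice f z)
    (integrable_fourierChar_smul_slice g z)]
  simp

variable (W V) in
/-- The Fourier transform in the first variable, as a real-linear operator. -/
def partialFourierReal : 𝓢(W × V, ℂ) →L[ℝ] 𝓢(W × V, ℂ) :=
  SchwartzMap.mkCLM partialFourierFun partialFourierFun_add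
    (fun a f z => by
      simp only [partialFourierFun, RingHom.id_apply]
      rw [← integral_smul]
      refine integral_congr_ae (Eventually.of_forall fun y => ?_)
      exact smul_comm (Real.fourierChar (-⟪y, z.1⟫)) a (f (y, z.2)))
    (fun f => contDiff_infty.2 fun n => contDiff_partialFourierFun n f)
    (fun n => (seminormBounded_iteratedFDeriv_partialFourierFun n.1 n.2).exists_finset)

variable (W V) in
/-- The Fourier transform in the first variable on the Schwartz space. -/
def partialFourier : 𝓢(W × V, ℂ) →L[ℂ] 𝓢(W × V, ℂ) where
  toFun := partialFourierReal W V
  map_add' := map_add _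
  map_smul' c f := by
    ext z
    change partialFourierFun (c • f) z = c • partialFourierFun f z
    simp only [partialFourierFun]
    rw [← integral_smul]
    refine integral_congr_ae (Eventually.of_forall fun y => ?_)
    exact smul_comm (Real.fourierChar (-⟪y, z.1⟫)) c (f (y, z.2))
  cont := (partialFourierReal W V).continuous

theorem partialFourier_apply (Ψ : 𝓢(W × V, ℂ)) (z : W × V) :
    partialFourier W V Ψ z = ∫ y, Real.fourierChar (-⟪y, z.1⟫) • Ψ (y, z.2) := rfl

end PartialFourier

/-! ### Interchanging a tempered distribution and an integral -/

section Interchange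

open LineDeriv

variable {X : Type} [NormedAddCommGroup X] [NormedSpace ℝ X]

/-- A finite set of Schwartz seminorms as the index set of an `ℓ^∞` space. -/
abbrev SeminormIndex (X : Type) (s : Finset (ℕ × ℕ)) : Type :=
  Σ kn : s, X × (Fin kn.1.2 → X)

/-- The weight that normalizes a directional derivative at a point. -/
def seminormWeight {s : Finset (ℕ × ℕ)} (i : SeminormIndex X s) : ℝ :=
  ‖i.2.1‖ ^ i.1.1.1 / ∏ j, ‖i.2.2 j‖

theorem norm_seminormWeight_smul_le {s : Finset (ℕ × ℕ)} (f : 𝓢(X, ℂ)) (i : SeminormIndex X s) :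
    ‖(seminormWeight i : ℂ) * (∂^{i.2.2} f) i.2.1‖ ≤
      SchwartzMap.seminorm ℂ i.1.1.1 i.1.1.2 f := by
  rw [norm_mul, Complex.norm_real, SchwartzMap.iteratedLineDerivOp_eq_iteratedFDeriv,
    seminormWeight, Real.norm_of_nonneg (by positivity)]
  rcases eq_or_ne (∏ j, ‖i.2.2 j‖) 0 with h | h
  · rw [h, div_zero, zero_mul]; exact apply_nonneg _ _
  have hpos : 0 < ∏ j, ‖i.2.2 j‖ := lt_of_le_of_ne (by positivity) h.symm
  rw [div_mul_eq_mul_div, div_le_iff₀ hpos]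
  calc _ ≤ ‖i.2.1‖ ^ i.1.1.1 * (‖iteratedFDeriv ℝ i.1.1.2 f i.2.1‖ * ∏ j, ‖i.2.2 j‖) := by
        gcongr; exact ContinuousMultilinearMap.le_opNorm _ _
    _ ≤ _ := by
        rw [← mul_assoc]; gcongr; exact SchwartzMap.le_seminorm ℂ _ _ f _

/-- The embedding of the Schwartz space into an `ℓ^∞` space given by finitely many seminorms. -/
def seminormEmbedding (X : Type) [NormedAddCommGroup X] [NormedSpace ℝ X] (s : Finset (ℕ × ℕ)) :
    𝓢(X, ℂ) →L[ℂ] lp (fun _ : SeminormIndex X s => ℂ) ∞ := by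
  have hle : ∀ (f : 𝓢(X, ℂ)) (i : SeminormIndex X s),
      ‖(seminormWeight i : ℂ) * (∂^{i.2.2} f) i.2.1‖ ≤
        s.sup (schwartzSeminormFamily ℂ X ℂ) f := fun f i =>
    (norm_seminormWeight_smul_le f i).trans
      (Seminorm.le_finset_sup_apply (p := schwartzSeminormFamily ℂ X ℂ) i.1.2)
  have hmem : ∀ f : 𝓢(X, ℂ), Memℓp (fun i : SeminormIndex X s =>
      (seminormWeight i : ℂ) * (∂^{i.2.2} f) i.2.1) ∞ := fun f =>
    memℓp_infty ⟨_, by rintro _ ⟨i, rfl⟩; exact hle f i⟩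
  exact SchwartzMap.mkCLMtoNormedSpace (fun f => ⟨_, hmem f⟩)
    (fun f g => by
      ext i
      change _ * (∂^{i.2.2} (f + g)) i.2.1 = _ * (∂^{i.2.2} f) i.2.1 + _ * (∂^{i.2.2} g) i.2.1
      rw [iteratedLineDerivOp_add, _root_.add_apply, mul_add])
    (fun a f => by
      ext i
      change _ * (∂^{i.2.2} (a • f)) i.2.1 = a * (_ * (∂^{i.2.2} f) i.2.1)
      rw [iteratedLineDerivOp_smul, _root_.smul_apply, smul_eq_mul]
      ring)
    ⟨s, 1, zero_le_one, fun f => by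
      rw [one_mul]
      exact lp.norm_le_of_forall_le (apply_nonneg _ _) (hle f)⟩

theorem seminormEmbedding_apply (s : Finset (ℕ × ℕ)) (f : 𝓢(X, ℂ)) (i : SeminormIndex X s) :
    (seminormEmbedding X s f : SeminormIndex X s → ℂ) i =
      (seminormWeight i : ℂ) * (∂^{i.2.2} f) i.2.1 := rfl

/-- The supremum over points and directions recovers the operator norm of each derivative, so the
`ℓ^∞` norm controls every seminorm of the finite set. Zero directions and vanishing weights are
treated apart, since the normalization degenerates there. -/
theorem seminorm_le_norm_seminormEmbedding {s : Finset (ℕ × ℕ)} {kn : ℕ × ℕ} (h : kn ∈ s)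
    (f : 𝓢(X, ℂ)) : SchwartzMap.seminorm ℂ kn.1 kn.2 f ≤ ‖seminormEmbedding X s f‖ := by
  refine SchwartzMap.seminorm_le_bound ℂ _ _ _ (norm_nonneg _) fun x => ?_
  rcases eq_or_ne (‖x‖ ^ kn.1) 0 with h0 | h0
  · rw [h0, zero_mul]; exact norm_nonneg _
  have hpos : 0 < ‖x‖ ^ kn.1 := lt_of_le_of_ne (by positivity) h0.symm
  rw [mul_comm, ← le_div_iff₀ hpos]
  refine ContinuousMultilinearMap.opNorm_le_bound (by positivity) fun m => ?_
  rcases eq_or_ne (∏ j, ‖m j‖) 0 with hm | hm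
  · obtain ⟨j, -, hj⟩ := Finset.prod_eq_zero_iff.1 hm
    rw [ContinuousMultilinearMap.map_coord_zero _ j (norm_eq_zero.1 hj), norm_zero]
    positivity
  have hmpos : 0 < ∏ j, ‖m j‖ := lt_of_le_of_ne (by positivity) hm.symm
  have := lp.norm_apply_le_norm ENNReal.top_ne_zero (seminormEmbedding X s f) ⟨⟨kn, h⟩, x, m⟩
  rw [seminormEmbedding_apply, norm_mul, Complex.norm_real,
    SchwartzMap.iteratedLineDerivOp_eq_iteratedFDeriv, seminormWeight,
    Real.norm_of_nonneg (by positivity)] at this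
  simp only at this
  rw [div_mul_eq_mul_div, div_le_iff₀ hmpos] at this
  rw [div_mul_eq_mul_div, le_div_iff₀ hpos, mul_comm]
  exact this

/-- A continuous functional on the Schwartz space factors through one of the embeddings. -/
theorem exists_extension_seminormEmbedding (u : 𝓢(X, ℂ) →L[ℂ] ℂ) :
    ∃ (s : Finset (ℕ × ℕ)) (U : lp (fun _ : SeminormIndex X s => ℂ) ∞ →L[ℂ] ℂ),
      ∀ f, u f = U (seminormEmbedding X s f) := by
  obtain ⟨s₀, C, -, hC⟩ := Seminorm.bound_of_continuous (schwartz_withSeminorms ℂ X ℂ)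
    ((normSeminorm ℂ ℂ).comp u.toLinearMap) (continuous_norm.comp u.continuous)
  -- Including the sup norm makes the embedding injective, so `u` descends to its range.
  set s := insert (0, 0) s₀
  set J := seminormEmbedding X s
  have hinj : Function.Injective J.toLinearMap := by
    rw [← LinearMap.ker_eq_bot, LinearMap.ker_eq_bot']
    intro f hf
    have h1 := seminorm_le_norm_seminormEmbedding (s := s) (Finset.mem_insert_self _ _) f
    have h2 : ‖seminormEmbedding X s f‖ = 0 := norm_eq_zero.2 hf
    ext x
    have h3 := SchwartzMap.norm_le_seminorm ℂ f x
    rw [h2] at h1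
    simpa using h3.trans h1
  have hbound : ∀ f, ‖u f‖ ≤ C * ‖J f‖ := fun f => by
    refine (hC f).trans (mul_le_mul_of_nonneg_left ?_ C.2)
    exact Seminorm.finset_sup_apply_le (norm_nonneg _) fun i hi =>
      seminorm_le_norm_seminormEmbedding (Finset.mem_insert_of_mem hi) f
  let e := LinearEquiv.ofInjective J.toLinearMap hinj
  have he : ∀ y, J (e.symm y) = y := fun y => congrArg Subtype.val (e.apply_symm_apply y)
  let f₀ := (u.toLinearMap ∘ₗ e.symm.toLinearMap).mkContinuous C fun y => by
    have := hbound (e.symm y)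
    rw [he y] at this
    exact this
  -- Hahn–Banach extends the bounded functional from the range to all of `ℓ^∞`.
  obtain ⟨U, hU, -⟩ := exists_extension_norm_eq (LinearMap.range J.toLinearMap) f₀
  refine ⟨s, U, fun f => ?_⟩
  have := hU (e f)
  change U (J f) = u (e.symm (e f)) at this
  rw [this, e.symm_apply_apply]

variable {Y : Type} [TopologicalSpace Y] [MeasurableSpace Y] [BorelSpace Y]
  [SecondCountableTopology Y] {ν : Measure Y}

/-- `ψ` is the pointwise integral of the continuous family `Ψ` of Schwartz functions, all of
whose seminorms are integrable. -/
structure IsSchwartzIntegral (ν : Measure Y) (Ψ : Y → 𝓢(X, ℂ)) (ψ : 𝓢(X, ℂ)) : Prop where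
  continuous : Continuous Ψ
  integrable : ∀ q : Seminorm ℝ 𝓢(X, ℂ), Continuous q → Integrable (fun y => q (Ψ y)) ν
  eq_integral : ∀ t, ψ t = ∫ y, Ψ y t ∂ν

theorem continuous_eval (t : X) {F : Type} [NormedAddCommGroup F] [NormedSpace ℝ F] :
    Continuous fun f : 𝓢(X, F) => f t :=
  (BoundedContinuousFunction.evalCLM ℝ t).continuous.comp
    (SchwartzMap.toBoundedContinuousFunctionCLM ℝ X F).continuous

/-- Differentiation under the integral, dominated by the integrable seminorm of order `(0, 1)`.
Stability under derivatives identifies all coordinates in `map_eq_integral`. -/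
theorem IsSchwartzIntegral.lineDeriv {Ψ : Y → 𝓢(X, ℂ)} {ψ : 𝓢(X, ℂ)}
    (h : IsSchwartzIntegral ν Ψ ψ) (m : X) :
    IsSchwartzIntegral ν (fun y => ∂_{m} (Ψ y)) (∂_{m} ψ) where
  continuous := (lineDerivOpCLM ℝ 𝓢(X, ℂ) m).continuous.comp h.continuous
  integrable q hq := h.integrable (q.comp (lineDerivOpCLM ℝ 𝓢(X, ℂ) m).toLinearMap)
    (hq.comp (lineDerivOpCLM ℝ 𝓢(X, ℂ) m).continuous)
  eq_integral t := by
    have hq : ∀ k n, Integrable (fun y => SchwartzMap.seminorm ℝ k n (Ψ y)) ν := fun k n =>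
      h.integrable _ ((schwartz_withSeminorms ℝ X ℂ).continuous_seminorm (k, n))
    have hmeas : ∀ t, AEStronglyMeasurable (fun y => Ψ y t) ν := fun t =>
      ((continuous_eval t).comp h.continuous).aestronglyMeasurable
    have hmeas' : AEStronglyMeasurable (fun y => fderiv ℝ (Ψ y) t) ν :=
      ((continuous_eval t).comp
        ((SchwartzMap.fderivCLM ℝ X ℂ).continuous.comp h.continuous)).aestronglyMeasurable
    have hbd : ∀ y t, ‖fderiv ℝ (Ψ y) t‖ ≤ SchwartzMap.seminorm ℝ 0 1 (Ψ y) := fun y t => by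
      have := SchwartzMap.norm_iteratedFDeriv_le_seminorm ℝ (Ψ y) 1 t
      rwa [norm_iteratedFDeriv_one] at this
    have key := hasFDerivAt_integral_of_dominated_of_fderiv_le (𝕜 := ℝ) (μ := ν) (x₀ := t)
      (F := fun t y => Ψ y t) (F' := fun t y => fderiv ℝ (Ψ y) t)
      (bound := fun y => SchwartzMap.seminorm ℝ 0 1 (Ψ y)) univ_mem
      (Eventually.of_forall hmeas)
      ((hq 0 0).mono' (hmeas t) (Eventually.of_forall fun y =>
        SchwartzMap.norm_le_seminorm ℝ (Ψ y) t)) hmeas'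
      (Eventually.of_forall fun y t _ => hbd y t) (hq 0 1)
      (Eventually.of_forall fun y t _ => (Ψ y).hasFDerivAt t)
    have hfun : (fun t => ∫ y, Ψ y t ∂ν) = ψ := funext fun t => (h.eq_integral t).symm
    rw [hfun] at key
    simp only [SchwartzMap.lineDerivOp_apply_eq_fderiv]
    rw [key.fderiv, ContinuousLinearMap.integral_apply
      ((hq 0 1).mono' hmeas' (Eventually.of_forall fun y => hbd y t))]

theorem IsSchwartzIntegral.iteratedLineDeriv {n : ℕ} (m : Fin n → X) :
    ∀ {Ψ : Y → 𝓢(X, ℂ)} {ψ : 𝓢(X, ℂ)}, IsSchwartzIntegral ν Ψ ψ →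
      IsSchwartzIntegral ν (fun y => ∂^{m} (Ψ y)) (∂^{m} ψ) := by
  induction n with
  | zero => intro Ψ ψ h; simpa only [iteratedLineDerivOp_fin_zero] using h
  | succ n ih =>
    intro Ψ ψ h
    simp only [iteratedLineDerivOp_succ_left]
    exact (ih _ h).lineDeriv _

theorem IsSchwartzIntegral.integrable_map {Ψ : Y → 𝓢(X, ℂ)} {ψ : 𝓢(X, ℂ)}
    (h : IsSchwartzIntegral ν Ψ ψ) {B : Type} [NormedAddCommGroup B] [NormedSpace ℂ B]
    (J : 𝓢(X, ℂ) →L[ℂ] B) : Integrable (fun y => J (Ψ y)) ν := by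
  refine (h.integrable (((normSeminorm ℂ B).comp J.toLinearMap).restrictScalars ℝ)
    (continuous_norm.comp J.continuous)).mono'
    (J.continuous.comp h.continuous).aestronglyMeasurable (Eventually.of_forall fun y => le_rfl)

/-- A tempered distribution may be applied under the integral sign. -/
theorem IsSchwartzIntegral.map_eq_integral {Ψ : Y → 𝓢(X, ℂ)} {ψ : 𝓢(X, ℂ)}
    (h : IsSchwartzIntegral ν Ψ ψ) (u : 𝓢(X, ℂ) →L[ℂ] ℂ) : u ψ = ∫ y, u (Ψ y) ∂ν := by
  obtain ⟨s, U, hU⟩ := exists_extension_seminormEmbedding u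
  simp only [hU]
  rw [U.integral_comp_comm (h.integrable_map (seminormEmbedding X s))]
  -- `U` has been moved outside a Bochner integral in `ℓ^∞`. It remains to identify that integral
  -- with the image of `ψ`, coordinate by coordinate; each coordinate is a weighted derivative at a
  -- point.
  congr 1
  refine lp.ext (funext fun i => ?_)
  have h1 := (lp.evalCLM ℂ (fun _ : SeminormIndex X s => ℂ) ∞ i).integral_comp_comm
    (h.integrable_map (seminormEmbedding X s))
  change ∫ y, (seminormEmbedding X s (Ψ y) : SeminormIndex X s → ℂ) i ∂ν = _ at h1
  simp only [seminormEmbedding_apply] at h1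
  rw [integral_const_mul, ← (h.iteratedLineDeriv i.2.2).eq_integral] at h1
  exact h1

end Interchange

/-! ### The short-time Fourier transform of a Schwartz function and the inversion formula -/

section SliceIntegral

variable {X Y : Type} [NormedAddCommGroup X] [NormedSpace ℝ X]
  [NormedAddCommGroup Y] [NormedSpace ℝ Y] [MeasurableSpace Y] [BorelSpace Y]
  {ν : Measure Y} [ν.HasTemperateGrowth]

theorem integrable_seminorm_slice (Θ : 𝓢(X × Y, ℂ)) (q : Seminorm ℝ 𝓢(X, ℂ))
    (hq : Continuous q) : Integrable (fun y => q (slice y Θ)) ν := by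
  obtain ⟨s, C, -, hC⟩ := Seminorm.bound_of_continuous (schwartz_withSeminorms ℝ X ℂ) q hq
  set N := ν.integrablePower
  set S : ℕ × ℕ → ℝ := fun m => 2 ^ (m.1 + N) * (Finset.Iic (m.1 + N, m.2)).sup
        (fun m => SchwartzMap.seminorm ℝ m.1 m.2) Θ
  have hS : ∀ m, 0 ≤ S m := fun m => by positivity
  refine ((ν.integrable_pow_neg_integrablePower).const_mul (C * ∑ m ∈ s, S m)).mono'
    (hq.comp (continuous_slice Θ)).aestronglyMeasurable (Eventually.of_forall fun y => ?_)
  rw [Real.norm_of_nonneg (apply_nonneg _ _), Real.rpow_neg (by positivity), Real.rpow_natCast,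
    ← div_eq_mul_inv, mul_div_assoc]
  refine (hC _).trans (mul_le_mul_of_nonneg_left ?_ C.2)
  refine Seminorm.finset_sup_apply_le (div_nonneg (Finset.sum_nonneg fun m _ => hS m)
    (by positivity)) fun m hm => ?_
  rw [le_div_iff₀ (by positivity), mul_comm]
  refine (seminorm_slice_le m.1 m.2 N y Θ).trans ?_
  exact Finset.single_le_sum (f := S) (fun m _ => hS m) hm

theorem isSchwartzIntegral_slice [SecondCountableTopology Y] {Θ : 𝓢(X × Y, ℂ)} {ψ : 𝓢(X, ℂ)}
    (h : ∀ t, ψ t = ∫ y, Θ (t, y) ∂ν) : IsSchwartzIntegral ν (fun y => slice y Θ) ψ :=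
  ⟨continuous_slice Θ, integrable_seminorm_slice Θ, h⟩

end SliceIntegral

section STFT

open scoped RealInnerProductSpace FourierTransform

variable {ι : Type} [Fintype ι]

local notation "E" => EuclideanSpace ℝ ι

instance instIsAddHaarMeasureVolumeProd :
    (volume : Measure (EuclideanSpace ℝ ι × EuclideanSpace ℝ ι)).IsAddHaarMeasure :=
  inferInstanceAs ((volume : Measure (EuclideanSpace ℝ ι)).prod
    (volume : Measure (EuclideanSpace ℝ ι))).IsAddHaarMeasure

instance instHasTemperateGrowthVolumeProd :
    (volume : Measure (EuclideanSpace ℝ ι × EuclideanSpace ℝ ι)).HasTemperateGrowth :=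
  Measure.IsAddHaarMeasure.instHasTemperateGrowth

/-- Complex conjugation as a real-linear operator. -/
def conjCLM (ι : Type) [Fintype ι] :
    𝓢(EuclideanSpace ℝ ι, ℂ) →L[ℝ] 𝓢(EuclideanSpace ℝ ι, ℂ) :=
  SchwartzMap.postcompCLM (𝕜 := ℝ) (Complex.conjCLE : ℂ →L[ℝ] ℂ)

theorem continuous_conjS : Continuous (conjS : 𝓢(E, ℂ) → 𝓢(E, ℂ)) := (conjCLM ι).continuous

@[simp]
theorem conjS_conjS (f : 𝓢(E, ℂ)) : conjS (conjS f) = f := by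
  ext t; simp [conjS_apply]

theorem conjS_add (f g : 𝓢(E, ℂ)) : conjS (f + g) = conjS f + conjS g :=
  (conjCLM ι).map_add f g

theorem conjS_smul (c : ℂ) (f : 𝓢(E, ℂ)) : conjS (c • f) = conj c • conjS f := by
  ext t; simp [conjS_apply]

theorem IsSchwartzIntegral.conj {Y : Type} [TopologicalSpace Y] [MeasurableSpace Y] [BorelSpace Y]
    [SecondCountableTopology Y] {ν : Measure Y} {Ψ : Y → 𝓢(E, ℂ)} {ψ : 𝓢(E, ℂ)}
    (h : IsSchwartzIntegral ν Ψ ψ) : IsSchwartzIntegral ν (fun y => conjS (Ψ y)) (conjS ψ) where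
  continuous := continuous_conjS.comp h.continuous
  integrable q hq := h.integrable (q.comp (conjCLM ι).toLinearMap) (hq.comp continuous_conjS)
  eq_integral t := by
    simp only [conjS_apply]
    rw [h.eq_integral, integral_conj]

/-- The shear `(t, x) ↦ (t, t - x)`. -/
def shearSnd (V : Type) [NormedAddCommGroup V] [NormedSpace ℝ V] : (V × V) ≃L[ℝ] (V × V) :=
  ContinuousLinearEquiv.equivOfInverse
    ((ContinuousLinearMap.fst ℝ V V).prod
      (ContinuousLinearMap.fst ℝ V V - ContinuousLinearMap.snd ℝ V V))
    ((ContinuousLinearMap.fst ℝ V V).prod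
      (ContinuousLinearMap.fst ℝ V V - ContinuousLinearMap.snd ℝ V V))
    (fun z => by ext1 <;> simp) (fun z => by ext1 <;> simp)

theorem shearSnd_apply {V : Type} [NormedAddCommGroup V] [NormedSpace ℝ V] (z : V × V) :
    shearSnd V z = (z.1, z.1 - z.2) := rfl

/-- The shear `(t, (ω, x)) ↦ (t - x, (ω, x))`. -/
def shearFst (V : Type) [NormedAddCommGroup V] [NormedSpace ℝ V] :
    (V × (V × V)) ≃L[ℝ] (V × (V × V)) :=
  ContinuousLinearEquiv.equivOfInverse
    ((ContinuousLinearMap.fst ℝ V (V × V) -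
      (ContinuousLinearMap.snd ℝ V V).comp (ContinuousLinearMap.snd ℝ V (V × V))).prod
      (ContinuousLinearMap.snd ℝ V (V × V)))
    ((ContinuousLinearMap.fst ℝ V (V × V) +
      (ContinuousLinearMap.snd ℝ V V).comp (ContinuousLinearMap.snd ℝ V (V × V))).prod
      (ContinuousLinearMap.snd ℝ V (V × V)))
    (fun z => by ext1 <;> simp) (fun z => by ext1 <;> simp)

theorem shearFst_apply {V : Type} [NormedAddCommGroup V] [NormedSpace ℝ V] (z : V × (V × V)) :
    shearFst V z = (z.1 - z.2.2, z.2) := rfl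

/-- The function `(t, x) ↦ φ t * conj (g (t - x))`. -/
def windowed (g : 𝓢(E, ℂ)) : 𝓢(E, ℂ) →L[ℂ] 𝓢(E × E, ℂ) :=
  (SchwartzMap.compCLMOfContinuousLinearEquiv ℂ (shearSnd E)).comp (tensorRight (conjS g))

theorem windowed_apply (g φ : 𝓢(E, ℂ)) (z : E × E) :
    windowed g φ z = φ z.1 * conj (g (z.1 - z.2)) := by
  simp [windowed, shearSnd_apply, conjS_apply]

/-- The short-time Fourier transform of a Schwartz function, as the Schwartz function
`(ω, x) ↦ V_g φ (x, ω)`. -/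
def stftS (g : 𝓢(E, ℂ)) : 𝓢(E, ℂ) →L[ℂ] 𝓢(E × E, ℂ) := (partialFourier E E).comp (windowed g)

theorem stftS_eq_fourier (g φ : 𝓢(E, ℂ)) (z : E × E) :
    stftS g φ z = 𝓕 (slice z.2 (windowed g φ) : E → ℂ) z.1 := by
  rw [Real.fourier_eq]; rfl

theorem fourierChar_coe (s : ℝ) :
    (Real.fourierChar s : ℂ) = Complex.exp (2 * Real.pi * Complex.I * (s : ℂ)) := by
  rw [Real.fourierChar_apply]; push_cast; ring_nf

theorem tfShift_eq (x ω : E) (g : 𝓢(E, ℂ)) (t : E) :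
    tfShift x ω g t = (Real.fourierChar ⟪t, ω⟫ : ℂ) * g (t - x) := by
  rw [tfShift_apply, fourierChar_coe]

theorem stftS_apply (g φ : 𝓢(E, ℂ)) (z : E × E) :
    stftS g φ z = ∫ t, φ t * conj (tfShift z.2 z.1 g t) := by
  change ∫ y, Real.fourierChar (-⟪y, z.1⟫) • windowed g φ (y, z.2) = _
  refine integral_congr_ae (Eventually.of_forall fun t => ?_)
  simp only [windowed_apply, tfShift_eq, map_mul, Circle.smul_def, smul_eq_mul,
    AddChar.map_neg_eq_inv, Circle.coe_inv_eq_conj]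
  ring

theorem fourierChar_hasTemperateGrowth :
    (fun s : ℝ => (Real.fourierChar s : ℂ)).HasTemperateGrowth := by
  have h := character_hasTemperateGrowth (EuclideanSpace.single (0 : Fin 1) (1 : ℝ))
  have h2 : (fun s : ℝ => (s • EuclideanSpace.single (0 : Fin 1) (1 : ℝ))).HasTemperateGrowth :=
    (ContinuousLinearMap.toSpanSingleton ℝ
      (EuclideanSpace.single (0 : Fin 1) (1 : ℝ))).hasTemperateGrowth
  have h3 := h.comp h2
  refine (congrArg Function.HasTemperateGrowth (funext fun s => ?_)).mpr h3
  rw [fourierChar_coe]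
  simp [inner_smul_left]

theorem modulation_hasTemperateGrowth :
    (fun p : E × (E × E) => (Real.fourierChar ⟪p.1, p.2.1⟫ : ℂ)).HasTemperateGrowth := by
  refine fourierChar_hasTemperateGrowth.comp (g := fun s : ℝ => (Real.fourierChar s : ℂ))
    (f := fun p : E × (E × E) => ⟪p.1, p.2.1⟫) ?_
  exact (innerSL ℝ : E →L[ℝ] E →L[ℝ] ℝ).bilinear_hasTemperateGrowth
    (f := fun p : E × (E × E) => p.1) (g := fun p : E × (E × E) => p.2.1)
    (ContinuousLinearMap.fst ℝ E (E × E)).hasTemperateGrowth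
    ((ContinuousLinearMap.fst ℝ E E).comp (ContinuousLinearMap.snd ℝ E (E × E))).hasTemperateGrowth

/-- The Schwartz function `(t, (ω, x)) ↦ V_g φ (x, ω) * (π(x, ω) g) t`. -/
def synthesisKernel (g φ : 𝓢(E, ℂ)) : 𝓢(E × (E × E), ℂ) :=
  SchwartzMap.smulLeftCLM ℂ (fun p : E × (E × E) => (Real.fourierChar ⟪p.1, p.2.1⟫ : ℂ))
    (SchwartzMap.compCLMOfContinuousLinearEquiv ℂ (shearFst E) (tensorRight (stftS g φ) g))

theorem synthesisKernel_apply (g φ : 𝓢(E, ℂ)) (t : E) (z : E × E) :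
    synthesisKernel g φ (t, z) = stftS g φ z * tfShift z.2 z.1 g t := by
  rw [synthesisKernel, SchwartzMap.smulLeftCLM_apply_apply modulation_hasTemperateGrowth]
  simp [tfShift_eq, shearFst_apply]
  ring

theorem slice_synthesisKernel (g φ : 𝓢(E, ℂ)) (z : E × E) :
    slice z (synthesisKernel g φ) = stftS g φ z • tfShift z.2 z.1 g := by
  ext t
  rw [slice_apply, synthesisKernel_apply]
  rfl

/-- The square of the `L²` norm. -/
def normSq (g : 𝓢(E, ℂ)) : ℝ := ∫ t, ‖g t‖ ^ 2

theorem integrable_norm_sq (g : 𝓢(E, ℂ)) : Integrable fun t => ‖g t‖ ^ 2 := by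
  have := (g.memLp 2 (volume : Measure E)).integrable_norm_pow (by norm_num)
  simpa using this

theorem normSq_pos {g : 𝓢(E, ℂ)} (hg : g ≠ 0) : 0 < normSq g := by
  rw [normSq, integral_pos_iff_support_of_nonneg (fun t => by positivity) (integrable_norm_sq g)]
  have hopen : IsOpen (Function.support fun t => ‖g t‖ ^ 2) :=
    (g.continuous.norm.pow 2).isOpen_support
  refine hopen.measure_pos _ ?_
  by_contra hne
  rw [Set.not_nonempty_iff_eq_empty, Function.support_eq_empty_iff] at hne
  exact hg (SchwartzMap.ext fun t => by simpa using congrFun hne t)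

theorem integral_mul_conj (g : 𝓢(E, ℂ)) : ∫ t, g t * conj (g t) = (normSq g : ℂ) := by
  rw [normSq, ← integral_complex_ofReal]
  refine integral_congr_ae (Eventually.of_forall fun t => ?_)
  simp [Complex.mul_conj, Complex.normSq_eq_norm_sq]

/-- For fixed `x`, `ω ↦ V_g φ(x, ω)` is the Fourier transform of a Schwartz slice; this is Fourier
inversion in `ω`. -/
theorem integral_fourierChar_mul_stftS (g φ : 𝓢(E, ℂ)) (t x : E) :
    ∫ ω, (Real.fourierChar ⟪t, ω⟫ : ℂ) * stftS g φ (ω, x) = φ t * conj (g (t - x)) := by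
  have h1 : 𝓕⁻ (𝓕 (slice x (windowed g φ))) = slice x (windowed g φ) :=
    FourierTransform.fourierInv_fourier_eq _
  have h2 := congrArg (fun f : 𝓢(E, ℂ) => f t) h1
  simp only [SchwartzMap.fourierInv_coe, slice_apply, windowed_apply] at h2
  rw [← h2, Real.fourierInv_eq]
  refine integral_congr_ae (Eventually.of_forall fun ω => ?_)
  simp only [Circle.smul_def, smul_eq_mul, stftS_eq_fourier, SchwartzMap.fourier_coe]
  rw [real_inner_comm]

/-- By Fubini, integrating over `ω` first leaves `φ t * |g (t - x)|²`, and the integral over `x` is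
then the squared norm of `g`. -/
theorem integral_synthesisKernel (g φ : 𝓢(E, ℂ)) (t : E) :
    ∫ z, synthesisKernel g φ (t, z) = normSq g * φ t := by
  have hint : Integrable (fun z : E × E => synthesisKernel g φ (t, z)) := by
    have h := (stftS g φ).integrable (μ := (volume : Measure (E × E)))
    have hcont : Continuous fun z : E × E => synthesisKernel g φ (t, z) :=
      (synthesisKernel g φ).continuous.comp (by fun_prop)
    refine (h.norm.mul_const (SchwartzMap.seminorm ℝ 0 0 g)).mono' hcont.aestronglyMeasurable
      (Eventually.of_forall fun z => ?_)
    rw [synthesisKernel_apply, norm_mul, tfShift_eq, norm_mul, Circle.norm_coe, one_mul]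
    gcongr
    exact SchwartzMap.norm_le_seminorm ℝ g _
  rw [Measure.volume_eq_prod] at hint ⊢
  rw [integral_prod_symm _ hint]
  have h1 : ∀ x : E, ∫ ω, synthesisKernel g φ (t, (ω, x)) =
      φ t * (g (t - x) * conj (g (t - x))) := fun x => by
    calc _ = ∫ ω, ((Real.fourierChar ⟪t, ω⟫ : ℂ) * stftS g φ (ω, x)) * g (t - x) := by
          refine integral_congr_ae (Eventually.of_forall fun ω => ?_)
          simp only [synthesisKernel_apply, tfShift_eq]
          ring
      _ = _ := by rw [integral_mul_const, integral_fourierChar_mul_stftS]; ring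
  simp only [h1]
  rw [integral_const_mul, integral_sub_left_eq_self (fun s => g s * conj (g s)) volume t,
    integral_mul_conj, mul_comm]

/-- The inversion formula at the level of Schwartz seminorms: the integrand consists of slices of a
single Schwartz function on `E × (E × E)`, which supplies both continuity and integrability. -/
theorem isSchwartzIntegral_synthesis (g φ : 𝓢(E, ℂ)) :
    IsSchwartzIntegral volume (fun z : E × E => stftS g φ z • tfShift z.2 z.1 g)
      ((normSq g : ℂ) • φ) := by
  have : IsSchwartzIntegral volume (fun z : E × E => slice z (synthesisKernel g φ))
      ((normSq g : ℂ) • φ) :=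
    isSchwartzIntegral_slice fun t => (integral_synthesisKernel g φ t).symm
  simpa only [slice_synthesisKernel] using this

/-- The inversion formula for the short-time Fourier transform, tested with `φ`. -/
theorem normSq_mul_apply (g φ : 𝓢(E, ℂ)) (u : 𝓢(E, ℂ) →L[ℂ] ℂ) :
    (normSq g : ℂ) * u φ = ∫ z : E × E, stftS g φ z * u (tfShift z.2 z.1 g) := by
  simpa using (isSchwartzIntegral_synthesis g φ).map_eq_integral u

theorem bracket_add_right (u : 𝓢'(E, ℂ)) (φ ψ : 𝓢(E, ℂ)) :
    bracket u (φ + ψ) = bracket u φ + bracket u ψ := by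
  simp [bracket, conjS_add]

theorem bracket_smul_right (u : 𝓢'(E, ℂ)) (c : ℂ) (φ : 𝓢(E, ℂ)) :
    bracket u (c • φ) = conj c * bracket u φ := by
  simp [bracket, conjS_smul]

/-- A tempered distribution as a continuous linear functional. -/
def toCLM (u : 𝓢'(E, ℂ)) : 𝓢(E, ℂ) →L[ℂ] ℂ :=
  (ContinuousLinearMap.toUniformConvergenceCLM (RingHom.id ℂ) ℂ _).symm u

theorem toCLM_apply (u : 𝓢'(E, ℂ)) (φ : 𝓢(E, ℂ)) : toCLM u φ = u φ := rfl

/-- The inversion formula for the short-time Fourier transform. -/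
theorem normSq_mul_bracket (g h : 𝓢(E, ℂ)) (u : 𝓢'(E, ℂ)) :
    (normSq g : ℂ) * bracket u h = ∫ z : E × E, conj (stftS g h z) * stft g u z.2 z.1 := by
  have := (isSchwartzIntegral_synthesis g h).conj.map_eq_integral (toCLM u)
  rw [conjS_smul, Complex.conj_ofReal, map_smul, smul_eq_mul] at this
  simpa [conjS_smul, toCLM_apply, stft, bracket] using this

theorem stftS_tfShift_self (g : 𝓢(E, ℂ)) (z : E × E) :
    stftS g (tfShift z.2 z.1 g) z = normSq g := by
  rw [stftS_apply, ← integral_mul_conj,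
    ← integral_sub_right_eq_self (fun t => g t * conj (g t)) z.2]
  refine integral_congr_ae (Eventually.of_forall fun t => ?_)
  simp only [tfShift_eq, map_mul]
  rw [mul_mul_mul_comm, Complex.mul_conj, Complex.normSq_eq_norm_sq, Circle.norm_coe]
  simp

/-- The products `V_g φ(z) π(z)g` are slices of a Schwartz function, hence continuous in `z`. For `φ
= π(z₀)g` the scalar is nonzero at `z₀`, so it can be divided out nearby. -/
theorem continuous_tfShift (g : 𝓢(E, ℂ)) : Continuous fun z : E × E => tfShift z.2 z.1 g := by
  rcases eq_or_ne g 0 with rfl | hg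
  · have : (fun z : E × E => tfShift z.2 z.1 (0 : 𝓢(E, ℂ))) = fun _ => 0 := by
      funext z; ext t; simp [tfShift_eq]
    rw [this]; exact continuous_const
  rw [continuous_iff_continuousAt]
  intro z₀
  set φ := tfShift z₀.2 z₀.1 g
  have h0 : stftS g φ z₀ ≠ 0 := by
    rw [stftS_tfShift_self]
    exact_mod_cast (normSq_pos hg).ne'
  have h1 : ContinuousAt (fun z : E × E => (stftS g φ z)⁻¹ • slice z (synthesisKernel g φ)) z₀ :=
    ((stftS g φ).continuous.continuousAt.inv₀ h0).smul (continuous_slice _).continuousAt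
  refine h1.congr ?_
  filter_upwards [(stftS g φ).continuous.continuousAt.eventually_ne h0] with z hz
  rw [slice_synthesisKernel, smul_smul, inv_mul_cancel₀ hz, one_smul]

theorem continuous_stft (g : 𝓢(E, ℂ)) (u : 𝓢'(E, ℂ)) :
    Continuous fun z : E × E => stft g u z.2 z.1 :=
  (toCLM u).continuous.comp (continuous_conjS.comp (continuous_tfShift g))

theorem norm_stftS_tfShift (g φ : 𝓢(E, ℂ)) (x ω : E) (z : E × E) :
    ‖stftS g (tfShift x ω φ) z‖ = ‖stftS g φ (z.1 - ω, z.2 - x)‖ := by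
  have : stftS g (tfShift x ω φ) z =
      (Real.fourierChar ⟪x, ω - z.1⟫ : ℂ) * stftS g φ (z.1 - ω, z.2 - x) := by
    rw [stftS_apply, stftS_apply, ← integral_add_right_eq_self _ x, ← integral_const_mul]
    refine integral_congr_ae (Eventually.of_forall fun t => ?_)
    simp only [tfShift_eq, map_mul, inner_add_left, inner_sub_right, AddChar.map_add_eq_mul,
      AddChar.map_sub_eq_div, Circle.coe_mul, Circle.coe_div, add_sub_cancel_right]
    have e : ∀ a : Circle, conj (a : ℂ) = (a : ℂ)⁻¹ := fun a => (Circle.coe_inv_eq_conj a) ▸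
      (Circle.coe_inv a)
    simp only [map_div₀, e, sub_sub_eq_add_sub]
    have e' : ∀ a : Circle, (a : ℂ) ≠ 0 := fun a => a.coe_ne_zero
    field_simp [e']
  rw [this, norm_mul, Circle.norm_coe, one_mul]

end STFT

/-! ### Matrix-Wigner distributions of Schwartz functions -/

section Halves

open scoped RealInnerProductSpace

variable {d : ℕ}

local notation "E" => EuclideanSpace ℝ (Fin d)
local notation "E₂" => EuclideanSpace ℝ (Fin d ⊕ Fin d)

/-- The point `(x, ω)` of `ℝ^{2d}`. -/
def joinHalves (x ω : E) : E₂ := WithLp.toLp 2 (Sum.elim x.ofLp ω.ofLp)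

@[simp] theorem fstHalf_joinHalves (x ω : E) : fstHalf (joinHalves x ω) = x := rfl
@[simp] theorem sndHalf_joinHalves (x ω : E) : sndHalf (joinHalves x ω) = ω := rfl

@[simp] theorem joinHalves_halves (z : E₂) : joinHalves (fstHalf z) (sndHalf z) = z := by
  ext i; cases i <;> rfl

theorem fstHalf_sub (z z' : E₂) : fstHalf (z - z') = fstHalf z - fstHalf z' := rfl
theorem sndHalf_sub (z z' : E₂) : sndHalf (z - z') = sndHalf z - sndHalf z' := rfl

theorem inner_eq_halves (z z' : E₂) :
    ⟪z, z'⟫ = ⟪fstHalf z, fstHalf z'⟫ + ⟪sndHalf z, sndHalf z'⟫ := by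
  simp [PiLp.inner_apply, Fintype.sum_sum_type, fstHalf, sndHalf]

/-- The linear equivalence `(x, ω) ↦ (ω, x)` from `ℝ^{2d}` to `ℝ^d × ℝ^d`. -/
def halvesEquiv (d : ℕ) : EuclideanSpace ℝ (Fin d ⊕ Fin d) ≃L[ℝ]
    EuclideanSpace ℝ (Fin d) × EuclideanSpace ℝ (Fin d) :=
  LinearEquiv.toContinuousLinearEquiv
    { toFun := fun z => (sndHalf z, fstHalf z)
      invFun := fun p => joinHalves p.2 p.1
      map_add' := fun _ _ => rfl
      map_smul' := fun _ _ => rfl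
      left_inv := fun z => joinHalves_halves z
      right_inv := fun _ => rfl }

theorem halvesEquiv_apply (z : E₂) : halvesEquiv d z = (sndHalf z, fstHalf z) := rfl

/-- The action of a matrix as a continuous linear map. -/
def matCLM (B : Matrix (Fin d) (Fin d) ℝ) : E →L[ℝ] E :=
  LinearMap.toContinuousLinearMap
    { toFun := matAct B
      map_add' := fun x y => by ext i; simp [matAct, Matrix.mulVec_add]
      map_smul' := fun c x => by ext i; simp [matAct, Matrix.mulVec_smul] }

theorem matCLM_apply (B : Matrix (Fin d) (Fin d) ℝ) (x : E) : matCLM B x = matAct B x := rfl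

theorem matAct_add (B : Matrix (Fin d) (Fin d) ℝ) (x y : E) :
    matAct B (x + y) = matAct B x + matAct B y := (matCLM B).map_add x y

theorem matAct_sub (B : Matrix (Fin d) (Fin d) ℝ) (x y : E) :
    matAct B (x - y) = matAct B x - matAct B y := (matCLM B).map_sub x y

theorem matAct_matAct (B C : Matrix (Fin d) (Fin d) ℝ) (x : E) :
    matAct B (matAct C x) = matAct (B * C) x := by
  ext i; simp [matAct, Matrix.mulVec_mulVec]

theorem matAct_add_matrix (B C : Matrix (Fin d) (Fin d) ℝ) (x : E) :
    matAct (B + C) x = matAct B x + matAct C x := by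
  ext i; simp [matAct, Matrix.add_mulVec]

@[simp] theorem matAct_one (x : E) : matAct 1 x = x := by ext i; simp [matAct]

@[simp] theorem matAct_zero_matrix (x : E) : matAct 0 x = 0 := by ext i; simp [matAct]

theorem inner_matAct_transpose (B : Matrix (Fin d) (Fin d) ℝ) (x w : E) :
    ⟪x, matAct Bᵀ w⟫ = ⟪matAct B x, w⟫ := by
  simp only [EuclideanSpace.inner_eq_star_dotProduct, matAct, star_trivial]
  rw [Matrix.mulVec_transpose, ← Matrix.dotProduct_mulVec]

/-- The block form of `M * N = 1`. -/
theorem blocks_of_mul_eq_one {M N : Matrix (Fin d ⊕ Fin d) (Fin d ⊕ Fin d) ℝ} (h : M * N = 1) :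
    M.toBlocks₁₁ * N.toBlocks₁₁ + M.toBlocks₁₂ * N.toBlocks₂₁ = 1 ∧
    M.toBlocks₁₁ * N.toBlocks₁₂ + M.toBlocks₁₂ * N.toBlocks₂₂ = 0 ∧
    M.toBlocks₂₁ * N.toBlocks₁₁ + M.toBlocks₂₂ * N.toBlocks₂₁ = 0 ∧
    M.toBlocks₂₁ * N.toBlocks₁₂ + M.toBlocks₂₂ * N.toBlocks₂₂ = 1 := by
  rw [← Matrix.fromBlocks_toBlocks M, ← Matrix.fromBlocks_toBlocks N, Matrix.fromBlocks_multiply,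
    ← Matrix.fromBlocks_one, Matrix.fromBlocks_inj] at h
  exact h

theorem matAct_blocks_mul {M N : Matrix (Fin d ⊕ Fin d) (Fin d ⊕ Fin d) ℝ} (h : M * N = 1)
    (x y : E) :
    matAct M.toBlocks₁₁ (matAct N.toBlocks₁₁ x + matAct N.toBlocks₁₂ y) +
      matAct M.toBlocks₁₂ (matAct N.toBlocks₂₁ x + matAct N.toBlocks₂₂ y) = x ∧
    matAct M.toBlocks₂₁ (matAct N.toBlocks₁₁ x + matAct N.toBlocks₁₂ y) +
      matAct M.toBlocks₂₂ (matAct N.toBlocks₂₁ x + matAct N.toBlocks₂₂ y) = y := by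
  obtain ⟨h1, h2, h3, h4⟩ := blocks_of_mul_eq_one h
  simp only [matAct_add, matAct_matAct]
  constructor
  · rw [add_add_add_comm, ← matAct_add_matrix, ← matAct_add_matrix, h1, h2]; simp
  · rw [add_add_add_comm, ← matAct_add_matrix, ← matAct_add_matrix, h3, h4]; simp

/-- The linear equivalence `(y, x) ↦ (A₁₁ x + A₁₂ y, A₂₁ x + A₂₂ y)`. -/
def blockEquiv {A : Matrix (Fin d ⊕ Fin d) (Fin d ⊕ Fin d) ℝ} (hA : IsUnit A) :
    (E × E) ≃L[ℝ] (E × E) :=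
  ContinuousLinearEquiv.equivOfInverse
    (((matCLM A.toBlocks₁₁).comp (ContinuousLinearMap.snd ℝ E E) +
      (matCLM A.toBlocks₁₂).comp (ContinuousLinearMap.fst ℝ E E)).prod
      ((matCLM A.toBlocks₂₁).comp (ContinuousLinearMap.snd ℝ E E) +
      (matCLM A.toBlocks₂₂).comp (ContinuousLinearMap.fst ℝ E E)))
    (((matCLM A⁻¹.toBlocks₂₁).comp (ContinuousLinearMap.fst ℝ E E) +
      (matCLM A⁻¹.toBlocks₂₂).comp (ContinuousLinearMap.snd ℝ E E)).prod
      ((matCLM A⁻¹.toBlocks₁₁).comp (ContinuousLinearMap.fst ℝ E E) +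
      (matCLM A⁻¹.toBlocks₁₂).comp (ContinuousLinearMap.snd ℝ E E)))
    (fun z => by
      have h := matAct_blocks_mul (Matrix.nonsing_inv_mul A ((Matrix.isUnit_iff_isUnit_det A).1 hA))
        z.2 z.1
      exact Prod.ext h.2 h.1)
    (fun z => by
      have h := matAct_blocks_mul (Matrix.mul_nonsing_inv A ((Matrix.isUnit_iff_isUnit_det A).1 hA))
        z.1 z.2
      exact Prod.ext h.1 h.2)

theorem blockEquiv_apply {A : Matrix (Fin d ⊕ Fin d) (Fin d ⊕ Fin d) ℝ} (hA : IsUnit A)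
    (z : E × E) : blockEquiv hA z =
      (matAct A.toBlocks₁₁ z.2 + matAct A.toBlocks₁₂ z.1,
        matAct A.toBlocks₂₁ z.2 + matAct A.toBlocks₂₂ z.1) := rfl

variable {A : Matrix (Fin d ⊕ Fin d) (Fin d ⊕ Fin d) ℝ} (hA : IsUnit A)

/-- The operator that sends `h ⊗ conj f` to the matrix-Wigner distribution of `h` and `f`. -/
def wignerOp : 𝓢(E × E, ℂ) →L[ℂ] 𝓢(E₂, ℂ) :=
  (SchwartzMap.compCLMOfContinuousLinearEquiv ℂ (halvesEquiv d)).comp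
    ((partialFourier E E).comp (SchwartzMap.compCLMOfContinuousLinearEquiv ℂ (blockEquiv hA)))

/-- The matrix-Wigner distribution of two Schwartz functions as a Schwartz function. -/
def wignerS (h f : 𝓢(E, ℂ)) : 𝓢(E₂, ℂ) := wignerOp hA (tensorRight (conjS f) h)

theorem wignerS_apply (h f : 𝓢(E, ℂ)) (z : E₂) :
    wignerS hA h f z = ∫ y, (Real.fourierChar (-⟪y, sndHalf z⟫) : ℂ) *
      (h (matAct A.toBlocks₁₁ (fstHalf z) + matAct A.toBlocks₁₂ y) *
      conj (f (matAct A.toBlocks₂₁ (fstHalf z) + matAct A.toBlocks₂₂ y))) := by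
  refine (partialFourier_apply _ _).trans ?_
  refine integral_congr_ae (Eventually.of_forall fun y => ?_)
  simp [blockEquiv_apply, halvesEquiv_apply, conjS_apply, Circle.smul_def]

theorem wignerS_eq_matrixWigner (h f : 𝓢(E, ℂ)) (z : E₂) :
    wignerS hA h f z = matrixWigner A h f z := by
  rw [wignerS_apply, matrixWigner]
  refine integral_congr_ae (Eventually.of_forall fun y => ?_)
  simp only [fourierChar_coe, Complex.ofReal_neg]
  ring_nf

/-- Covariance. With `(a, b) = A⁻¹(w₁, z₁)` the two translations become a translation of `(x, y)` by
`(a, b)`. Substituting `y + b` for `y` turns the second component into a modulation by `-b`. The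
modulations contribute a phase linear in `y`, which translates the frequency by `Q`, and one linear
in `x`. -/
theorem wignerS_tfShift (g f : 𝓢(E, ℂ)) (w₁ w₂ z₁ z₂ : E) : ∃ c : Circle,
    wignerS hA (tfShift w₁ w₂ g) (tfShift z₁ z₂ f) = (c : ℂ) •
      tfShift
        (joinHalves (matAct A⁻¹.toBlocks₁₁ w₁ + matAct A⁻¹.toBlocks₁₂ z₁)
          (matAct A.toBlocks₁₂ᵀ w₂ - matAct A.toBlocks₂₂ᵀ z₂))
        (joinHalves (matAct A.toBlocks₁₁ᵀ w₂ - matAct A.toBlocks₂₁ᵀ z₂)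
          (-(matAct A⁻¹.toBlocks₂₁ w₁ + matAct A⁻¹.toBlocks₂₂ z₁)))
        (wignerS hA g f) := by
  set a := matAct A⁻¹.toBlocks₁₁ w₁ + matAct A⁻¹.toBlocks₁₂ z₁
  set b := matAct A⁻¹.toBlocks₂₁ w₁ + matAct A⁻¹.toBlocks₂₂ z₁
  obtain ⟨hw, hz⟩ := matAct_blocks_mul
    (Matrix.mul_nonsing_inv A ((Matrix.isUnit_iff_isUnit_det A).1 hA)) w₁ z₁
  set Q := matAct A.toBlocks₁₂ᵀ w₂ - matAct A.toBlocks₂₂ᵀ z₂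
  refine ⟨Real.fourierChar ⟪b, Q⟫, ?_⟩
  ext z
  change _ = (Real.fourierChar ⟪b, Q⟫ : ℂ) * _
  rw [wignerS_apply, tfShift_eq, wignerS_apply, ← integral_add_right_eq_self _ b,
    ← integral_const_mul, ← integral_const_mul]
  refine integral_congr_ae (Eventually.of_forall fun y => ?_)
  simp only [tfShift_eq, fstHalf_sub, sndHalf_sub, fstHalf_joinHalves, sndHalf_joinHalves,
    map_mul, inner_eq_halves]
  have e1 : matAct A.toBlocks₁₁ (fstHalf z) + matAct A.toBlocks₁₂ (y + b) - w₁ =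
      matAct A.toBlocks₁₁ (fstHalf z - a) + matAct A.toBlocks₁₂ y := by
    conv_lhs => rw [← hw]
    rw [matAct_add, matAct_sub]; abel
  have e2 : matAct A.toBlocks₂₁ (fstHalf z) + matAct A.toBlocks₂₂ (y + b) - z₁ =
      matAct A.toBlocks₂₁ (fstHalf z - a) + matAct A.toBlocks₂₂ y := by
    conv_lhs => rw [← hz]
    rw [matAct_add, matAct_sub]; abel
  rw [e1, e2]
  -- All phases are collected into one character, so the identity reduces to a bilinear identity
  -- between inner products.
  have e3 : (Real.fourierChar (-⟪y + b, sndHalf z⟫) : ℂ) *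
      (Real.fourierChar ⟪matAct A.toBlocks₁₁ (fstHalf z) + matAct A.toBlocks₁₂ (y + b), w₂⟫ : ℂ) *
      conj (Real.fourierChar
        ⟪matAct A.toBlocks₂₁ (fstHalf z) + matAct A.toBlocks₂₂ (y + b), z₂⟫ : ℂ) =
      (Real.fourierChar ⟪b, Q⟫ : ℂ) *
      (Real.fourierChar (⟪fstHalf z, matAct A.toBlocks₁₁ᵀ w₂ - matAct A.toBlocks₂₁ᵀ z₂⟫ +
        ⟪sndHalf z, -b⟫) : ℂ) * (Real.fourierChar (-⟪y, sndHalf z - Q⟫) : ℂ) := by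
    rw [← Circle.coe_inv_eq_conj, ← AddChar.map_neg_eq_inv]
    simp only [← Circle.coe_mul, ← AddChar.map_add_eq_mul]
    congr 2
    simp only [Q, matAct_add, inner_add_left, inner_sub_right, inner_neg_right,
      inner_matAct_transpose]
    rw [real_inner_comm (sndHalf z) b]
    ring
  linear_combination (g (matAct A.toBlocks₁₁ (fstHalf z - a) + matAct A.toBlocks₁₂ y) *
    conj (f (matAct A.toBlocks₂₁ (fstHalf z - a) + matAct A.toBlocks₂₂ y))) * e3

theorem norm_bracket_wignerS_tfShift (σ : 𝓢'(E₂, ℂ)) (g f : 𝓢(E, ℂ)) (w₁ w₂ z₁ z₂ : E) :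
    ‖bracket σ (wignerS hA (tfShift w₁ w₂ g) (tfShift z₁ z₂ f))‖ =
      ‖stft (wignerS hA g f) σ
        (joinHalves (matAct A⁻¹.toBlocks₁₁ w₁ + matAct A⁻¹.toBlocks₁₂ z₁)
          (matAct A.toBlocks₁₂ᵀ w₂ - matAct A.toBlocks₂₂ᵀ z₂))
        (joinHalves (matAct A.toBlocks₁₁ᵀ w₂ - matAct A.toBlocks₂₁ᵀ z₂)
          (-(matAct A⁻¹.toBlocks₂₁ w₁ + matAct A⁻¹.toBlocks₂₂ z₁)))‖ := by
  obtain ⟨c, hc⟩ := wignerS_tfShift hA g f w₁ w₂ z₁ z₂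
  rw [hc, bracket_smul_right, norm_mul, RCLike.norm_conj, Circle.norm_coe, one_mul]
  rfl

/-- The tempered distribution `v` with `⟨v, h⟩ = ⟨σ, L h⟩`. -/
def adjointAction (L : 𝓢(E, ℂ) →L[ℂ] 𝓢(E₂, ℂ)) (σ : 𝓢'(E₂, ℂ)) : 𝓢'(E, ℂ) :=
  ContinuousLinearMap.toUniformConvergenceCLM (RingHom.id ℂ) ℂ _
    { toFun := fun φ => bracket σ (L (conjS φ))
      map_add' := fun φ ψ => by rw [conjS_add, map_add, bracket_add_right]
      map_smul' := fun c φ => by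
        rw [conjS_smul, map_smul, bracket_smul_right, Complex.conj_conj]; rfl
      cont := (toCLM σ).continuous.comp (continuous_conjS.comp
        (L.continuous.comp continuous_conjS)) }

theorem adjointAction_apply (L : 𝓢(E, ℂ) →L[ℂ] 𝓢(E₂, ℂ)) (σ : 𝓢'(E₂, ℂ)) (φ : 𝓢(E, ℂ)) :
    adjointAction L σ φ = bracket σ (L (conjS φ)) := rfl

theorem bracket_adjointAction (L : 𝓢(E, ℂ) →L[ℂ] 𝓢(E₂, ℂ)) (σ : 𝓢'(E₂, ℂ)) (h : 𝓢(E, ℂ)) :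
    bracket (adjointAction L σ) h = bracket σ (L h) := by
  rw [bracket, adjointAction_apply, conjS_conjS]

/-- `σ^A f` for a Schwartz function `f`. -/
def matrixOpS (σ : 𝓢'(E₂, ℂ)) (f : 𝓢(E, ℂ)) : 𝓢'(E, ℂ) :=
  adjointAction ((wignerOp hA).comp (tensorRight (conjS f))) σ

theorem bracket_matrixOpS (σ : 𝓢'(E₂, ℂ)) (f h : 𝓢(E, ℂ)) :
    bracket (matrixOpS hA σ f) h = bracket σ (wignerS hA h f) := bracket_adjointAction _ σ h

/-- The functional `f ↦ ⟨σ^A f, h⟩` on Schwartz functions. -/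
def matrixOpForm (σ : 𝓢'(E₂, ℂ)) (h : 𝓢(E, ℂ)) : 𝓢(E, ℂ) →L[ℂ] ℂ :=
  toCLM (adjointAction ((wignerOp hA).comp (tensorLeft h)) σ)

theorem matrixOpForm_apply (σ : 𝓢'(E₂, ℂ)) (f h : 𝓢(E, ℂ)) :
    matrixOpForm hA σ h f = bracket σ (wignerS hA h f) := by
  change bracket σ (wignerOp hA (tensorLeft h (conjS f))) = _
  rw [wignerS]
  congr 2
  ext z
  rw [tensorLeft_apply, tensorRight_apply]

end Halves

/-! ### Minkowski's integral inequality and mixed-norm spaces -/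

section Minkowski

variable {X Y : Type*} [MeasurableSpace X] [MeasurableSpace Y] {μ : Measure X} {ν : Measure Y}
  [SFinite μ] [SFinite ν]

/-- The pointwise bound holds for almost every `x` at each `y`; Fubini for null sets exchanges the
two quantifiers. -/
theorem eLpNorm_lintegral_le_top {f : X × Y → ℝ≥0∞} (hf : Measurable f)
    (hN : Measurable fun y => eLpNorm (fun x => f (x, y)) ∞ μ) :
    eLpNorm (fun x => ∫⁻ y, f (x, y) ∂ν) ∞ μ ≤ ∫⁻ y, eLpNorm (fun x => f (x, y)) ∞ μ ∂ν := by
  set N := fun y => eLpNorm (fun x => f (x, y)) ∞ μ with hNdef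
  have h1 : ∀ᵐ y ∂ν, ∀ᵐ x ∂μ, f (x, y) ≤ N y := Eventually.of_forall fun y => by
    have := enorm_ae_le_eLpNormEssSup (fun x => f (x, y)) μ
    simpa [hNdef] using this
  have h2 : ∀ᵐ x ∂μ, ∀ᵐ y ∂ν, f (x, y) ≤ N y :=
    (Measure.ae_ae_comm (p := fun x y => f (x, y) ≤ N y)
      (measurableSet_le hf (hN.comp measurable_snd))).2 h1
  rw [eLpNorm_exponent_top]
  refine eLpNormEssSup_le_of_ae_enorm_bound ?_
  filter_upwards [h2] with x hx
  simpa using lintegral_mono_ae hx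

theorem rpow_mul_rpow_neg_le {r t : ℝ} (hr : 0 < r) (h : r - t = 1)
    (a : ℝ≥0∞) : a ^ r * a ^ (-t) ≤ a := by
  rcases eq_or_ne a 0 with rfl | h0
  · simp [ENNReal.zero_rpow_of_pos hr]
  rcases eq_or_ne a ∞ with rfl | h1
  · simp
  rw [← ENNReal.rpow_add _ _ h0 h1, ← sub_eq_add_neg, h, ENNReal.rpow_one]

/-- No duality is needed. With `N y` the inner norm, write `f = (f N^(-1/s)) N^(1/s)`, apply Hölder
in `y`, raise to the power `r` and use Tonelli: the inner integral of `f ^ r N^(-r/s)` is at most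
`N`, because `r - r / s = 1`. -/
theorem lintegral_rpow_lintegral_le {f : X × Y → ℝ≥0∞} (hf : Measurable f) {r s : ℝ}
    (hrs : r.HolderConjugate s) :
    (∫⁻ x, (∫⁻ y, f (x, y) ∂ν) ^ r ∂μ) ^ (1 / r) ≤
      ∫⁻ y, (∫⁻ x, f (x, y) ^ r ∂μ) ^ (1 / r) ∂ν := by
  set N := fun y => (∫⁻ x, f (x, y) ^ r ∂μ) ^ (1 / r) with hNdef
  have hN : Measurable N := ((hf.pow_const r).lintegral_prod_left').pow_const _
  set m := ∫⁻ y, N y ∂ν with hm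
  have hr := hrs.pos
  have hs := hrs.symm.pos
  rcases eq_or_ne m ∞ with hm' | hm'
  · rw [hm']; exact le_top
  have hfin : ∀ᵐ y ∂ν, N y < ∞ := ae_lt_top hN hm'
  -- The factorization is delicate where `N y` is `0` or `∞`: in the first case `f` vanishes for
  -- almost every `x`, and the second is negligible because `m` is finite.
  have h1 : ∀ᵐ y ∂ν, ∀ᵐ x ∂μ, f (x, y) ≤ (f (x, y) * N y ^ (-(1 / s))) * N y ^ (1 / s) := by
    filter_upwards [hfin] with y hy
    rcases eq_or_ne (N y) 0 with h0 | h0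
    · have : ∫⁻ x, f (x, y) ^ r ∂μ = 0 := by
        rw [hNdef] at h0
        simpa [hr, hr.not_gt] using h0
      have hmy : Measurable fun x => f (x, y) ^ r := (hf.comp measurable_prodMk_right).pow_const r
      rw [lintegral_eq_zero_iff hmy] at this
      filter_upwards [this] with x hx
      have : f (x, y) = 0 := by simpa [hr, hr.not_gt] using hx
      simp [this]
    · refine Eventually.of_forall fun x => ?_
      rw [mul_assoc, ← ENNReal.rpow_add _ _ h0 hy.ne]
      simp
  have hfm : Measurable fun z : X × Y => f z * N z.2 ^ (-(1 / s)) :=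
    hf.mul ((hN.comp measurable_snd).pow_const _)
  have h2 : ∀ᵐ x ∂μ, ∀ᵐ y ∂ν, f (x, y) ≤ (f (x, y) * N y ^ (-(1 / s))) * N y ^ (1 / s) :=
    (Measure.ae_ae_comm
      (p := fun x y => f (x, y) ≤ (f (x, y) * N y ^ (-(1 / s))) * N y ^ (1 / s))
      (measurableSet_le hf (hfm.mul ((hN.comp measurable_snd).pow_const _)))).2 h1
  have h3 : ∀ᵐ x ∂μ, (∫⁻ y, f (x, y) ∂ν) ^ r ≤
      (∫⁻ y, f (x, y) ^ r * N y ^ (-(r / s)) ∂ν) * m ^ (r / s) := by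
    filter_upwards [h2] with x hx
    have hh := ENNReal.lintegral_mul_le_Lp_mul_Lq ν hrs
      (hfm.comp measurable_prodMk_left).aemeasurable (f := fun y => f (x, y) * N y ^ (-(1 / s)))
      (hN.pow_const (1 / s)).aemeasurable
    have hh2 := ENNReal.rpow_le_rpow ((lintegral_mono_ae hx).trans hh) hr.le
    refine hh2.trans (le_of_eq ?_)
    rw [ENNReal.mul_rpow_of_nonneg _ _ hr.le, ← ENNReal.rpow_mul, ← ENNReal.rpow_mul,
      one_div_mul_cancel hr.ne', ENNReal.rpow_one]
    congr 1
    · refine lintegral_congr fun y => ?_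
      rw [ENNReal.mul_rpow_of_nonneg _ _ hr.le, ← ENNReal.rpow_mul]
      congr 2
      ring
    · rw [hm]
      congr 1
      · refine lintegral_congr fun y => ?_
        rw [← ENNReal.rpow_mul, one_div_mul_cancel hs.ne', ENNReal.rpow_one]
      · ring
  have hrs' : r - r / s = 1 := by
    have := hrs.inv_add_inv_eq_one
    have h' : r * (r⁻¹ + s⁻¹) = r := by rw [this, mul_one]
    rw [mul_add, mul_inv_cancel₀ hr.ne'] at h'
    rw [div_eq_mul_inv]; linarith
  have h4 : ∫⁻ x, (∫⁻ y, f (x, y) ∂ν) ^ r ∂μ ≤ m ^ r := by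
    have hpos : 0 < r / s := div_pos hr hs
    calc ∫⁻ x, (∫⁻ y, f (x, y) ∂ν) ^ r ∂μ
        ≤ ∫⁻ x, (∫⁻ y, f (x, y) ^ r * N y ^ (-(r / s)) ∂ν) * m ^ (r / s) ∂μ :=
          lintegral_mono_ae h3
      _ = (∫⁻ x, ∫⁻ y, f (x, y) ^ r * N y ^ (-(r / s)) ∂ν ∂μ) * m ^ (r / s) :=
          lintegral_mul_const' _ _ (ENNReal.rpow_ne_top_of_nonneg hpos.le hm')
      _ = (∫⁻ y, ∫⁻ x, f (x, y) ^ r * N y ^ (-(r / s)) ∂μ ∂ν) * m ^ (r / s) := by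
          rw [lintegral_lintegral_swap]
          exact ((hf.pow_const r).mul ((hN.comp measurable_snd).pow_const _)).aemeasurable
      _ ≤ (∫⁻ y, N y ∂ν) * m ^ (r / s) := by
          gcongr with y
          rw [lintegral_mul_const (f := fun x => f (x, y) ^ r) _
            ((hf.comp measurable_prodMk_right).pow_const r)]
          have : ∫⁻ x, f (x, y) ^ r ∂μ = N y ^ r := by
            rw [hNdef]
            simp only
            rw [← ENNReal.rpow_mul, one_div_mul_cancel hr.ne', ENNReal.rpow_one]
          rw [this]
          exact rpow_mul_rpow_neg_le hr hrs' _
      _ = m ^ r := by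
          have : r = 1 + r / s := by linarith
          conv_rhs => rw [this, ENNReal.rpow_add_of_nonneg _ _ zero_le_one hpos.le,
            ENNReal.rpow_one]
  calc _ ≤ (m ^ r) ^ (1 / r) := ENNReal.rpow_le_rpow h4 (by positivity)
    _ = m := by rw [← ENNReal.rpow_mul, mul_one_div_cancel hr.ne', ENNReal.rpow_one]

/-- **Minkowski's integral inequality.** -/
theorem eLpNorm_lintegral_le {f : X × Y → ℝ≥0∞} (hf : Measurable f) {p : ℝ≥0∞} (hp : 1 ≤ p)
    (hN : Measurable fun y => eLpNorm (fun x => f (x, y)) p μ) :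
    eLpNorm (fun x => ∫⁻ y, f (x, y) ∂ν) p μ ≤ ∫⁻ y, eLpNorm (fun x => f (x, y)) p μ ∂ν := by
  rcases eq_or_ne p ∞ with rfl | hp'
  · exact eLpNorm_lintegral_le_top hf hN
  rcases hp.eq_or_lt with rfl | hp1
  · simp only [eLpNorm_one_eq_lintegral_enorm, enorm_eq_self]
    rw [lintegral_lintegral_swap (f := fun x y => f (x, y)) hf.aemeasurable]
  have h0 : p ≠ 0 := (zero_lt_one.trans hp1).ne'
  simp only [eLpNorm_eq_lintegral_rpow_enorm_toReal h0 hp', enorm_eq_self]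
  have h1 : 1 < p.toReal := by
    rw [← ENNReal.toReal_one]; exact (ENNReal.toReal_lt_toReal (by simp) hp').2 hp1
  exact lintegral_rpow_lintegral_le hf (Real.HolderConjugate.conjExponent h1)

end Minkowski

/-! ### Linear changes of variables in Lebesgue norms. -/

section Scaling

variable {V W : Type*} [NormedAddCommGroup V] [NormedSpace ℝ V] [FiniteDimensional ℝ V]
  [MeasurableSpace V] [BorelSpace V] [NormedAddCommGroup W] [NormedSpace ℝ W]
  [FiniteDimensional ℝ W] [MeasurableSpace W] [BorelSpace W]
  (μ : Measure V) [μ.IsAddHaarMeasure] (ν : Measure W) [ν.IsAddHaarMeasure]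

theorem exists_map_eq_smul (L : V ≃L[ℝ] W) : ∃ c : ℝ≥0, c ≠ 0 ∧ μ.map L = c • ν := by
  have := L.isAddHaarMeasure_map μ
  exact ⟨_, (Measure.addHaarScalarFactor_pos_of_isAddHaarMeasure (μ.map L) ν).ne',
    Measure.isAddLeftInvariant_eq_smul (μ.map L) ν⟩

theorem exists_lintegral_comp_eq (L : V ≃L[ℝ] W) : ∃ c : ℝ≥0, ∀ (f : W → ℝ≥0∞) (w : W),
    ∫⁻ v, f (L v + w) ∂μ = c * ∫⁻ y, f y ∂ν := by
  obtain ⟨c, -, hc⟩ := exists_map_eq_smul μ ν L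
  refine ⟨c, fun f w => ?_⟩
  have h1 : ∫⁻ v, f (L v + w) ∂μ = ∫⁻ y, f (y + w) ∂(μ.map L) :=
    (lintegral_map_equiv (fun y => f (y + w)) L.toHomeomorph.toMeasurableEquiv).symm
  rw [h1, hc, lintegral_add_right_eq_self, lintegral_smul_measure, ENNReal.smul_def, smul_eq_mul]

theorem eLpNorm_comp_add (f : V → ℝ≥0∞) (v : V) (p : ℝ≥0∞) :
    eLpNorm (fun y => f (y + v)) p μ = eLpNorm f p μ := by
  have := ((MeasurableEquiv.addRight v).measurableEmbedding.eLpNorm_map_measure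
    (g := f) (p := p) (μ := μ))
  rw [MeasurableEquiv.coe_addRight, (measurePreserving_add_right μ v).map_eq] at this
  exact this.symm

/-- The Jacobian factor is `c ^ (1/p)` with `1/p` in `[0, 1]`, hence at most `max 1 c`. This makes
the constant independent of `p`. -/
theorem exists_eLpNorm_comp_le (L : V ≃L[ℝ] W) : ∃ c : ℝ≥0, ∀ (f : W → ℝ≥0∞) (w : W) (p : ℝ≥0∞),
    1 ≤ p → eLpNorm (fun v => f (L v + w)) p μ ≤ c * eLpNorm f p ν := by
  obtain ⟨c, hc0, hc⟩ := exists_map_eq_smul μ ν L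
  refine ⟨max 1 c, fun f w p hp => ?_⟩
  have h1 : eLpNorm (fun v => f (L v + w)) p μ = eLpNorm (fun y => f (y + w)) p (μ.map L) :=
    (L.toHomeomorph.toMeasurableEquiv.measurableEmbedding.eLpNorm_map_measure
      (g := fun y => f (y + w))).symm
  rw [h1, hc, eLpNorm_smul_measure_of_ne_zero' hc0, eLpNorm_comp_add ν, ENNReal.smul_def, smul_eq_mul]
  gcongr
  have hp1 : p.toReal⁻¹ ≤ 1 := by
    rw [← ENNReal.toReal_one, ← ENNReal.toReal_inv]
    exact ENNReal.toReal_mono (by simp) (ENNReal.inv_le_one.2 hp)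
  rcases le_total c 1 with h | h
  · exact (NNReal.rpow_le_one h (by positivity)).trans (le_max_left _ _)
  · exact (NNReal.rpow_le_rpow_of_exponent_le h hp1).trans ((NNReal.rpow_one c).trans_le
      (le_max_right _ _))

end Scaling

/-! ### Essential suprema of continuous functions and measurability of slice norms. -/

section EssSup

variable {X : Type*} [TopologicalSpace X] [MeasurableSpace X] [OpensMeasurableSpace X]
  {μ : Measure X} [μ.IsOpenPosMeasure]

theorem enorm_le_eLpNormEssSup {f : X → ℝ≥0∞} (hf : Continuous f) (x : X) :
    f x ≤ eLpNormEssSup f μ := by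
  by_contra! h
  have hopen : IsOpen {y | eLpNormEssSup f μ < f y} := isOpen_lt continuous_const hf
  refine (hopen.measure_pos μ ⟨x, h⟩).ne' ?_
  have := enorm_ae_le_eLpNormEssSup f μ
  rw [ae_iff] at this
  simpa using this

theorem eLpNormEssSup_eq_iSup {f : X → ℝ≥0∞} (hf : Continuous f) :
    eLpNormEssSup f μ = ⨆ x, f x :=
  le_antisymm (eLpNormEssSup_le_of_ae_enorm_bound (Eventually.of_forall fun x =>
    le_iSup f x)) (iSup_le (enorm_le_eLpNormEssSup hf))

/-- By continuity the essential supremum is a supremum, and a supremum of continuous functions is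
lower semicontinuous. -/
theorem measurable_eLpNormEssSup {Y : Type*} [TopologicalSpace Y] [MeasurableSpace Y]
    [OpensMeasurableSpace Y] {F : Y × X → ℝ≥0∞} (hF : Continuous F) :
    Measurable fun y => eLpNormEssSup (fun x => F (y, x)) μ := by
  have h : (fun y => eLpNormEssSup (fun x => F (y, x)) μ) = fun y => ⨆ x, F (y, x) :=
    funext fun y => eLpNormEssSup_eq_iSup (hF.comp (by fun_prop))
  rw [h]
  exact (lowerSemicontinuous_iSup fun x =>
    (Continuous.lowerSemicontinuous (hF.comp (by fun_prop)))).measurable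

theorem measurable_eLpNorm_slice [SFinite μ] {Y : Type*} [TopologicalSpace Y] [MeasurableSpace Y]
    [OpensMeasurableSpace Y] {F : Y × X → ℝ≥0∞} (hF : Continuous F) (hFm : Measurable F)
    {p : ℝ≥0∞} (hp : 1 ≤ p) :
    Measurable fun y => eLpNorm (fun x => F (y, x)) p μ := by
  rcases eq_or_ne p ∞ with rfl | hp'
  · simpa only [eLpNorm_exponent_top] using measurable_eLpNormEssSup hF
  simp only [eLpNorm_eq_lintegral_rpow_enorm_toReal (zero_lt_one.trans_le hp).ne' hp',
    enorm_eq_self]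
  exact ((hFm.pow_const _).lintegral_prod_right').pow_const _

end EssSup

/-! ### Mixed norms and convolution-type operators. -/

section MixedNorm

variable {ι : Type} [Fintype ι]

local notation "E" => EuclideanSpace ℝ ι

/-- The mixed norm `‖F‖_{p,q}`, with the exponent `p` in the second variable. -/
def mixedNorm (p q : ℝ≥0∞) (F : E × E → ℝ≥0∞) : ℝ≥0∞ :=
  eLpNorm (fun a : E => eLpNorm (fun b : E => F (a, b)) p volume) q volume

theorem modNorm_eq_mixedNorm (g : 𝓢(E, ℂ)) (p q : ℝ≥0∞) (u : 𝓢'(E, ℂ)) :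
    modNorm g p q u = mixedNorm p q fun z => ‖stft g u z.2 z.1‖ₑ := by
  simp only [modNorm, mixedNorm, eLpNorm_enorm]

theorem mixedNorm_mono {p q : ℝ≥0∞} {F K : E × E → ℝ≥0∞} (h : ∀ z, F z ≤ K z) :
    mixedNorm p q F ≤ mixedNorm p q K :=
  eLpNorm_mono_enorm fun a => by
    simpa using eLpNorm_mono_enorm fun b => by simpa using h (a, b)

theorem mixedNorm_comp_sub {p q : ℝ≥0∞} (F : E × E → ℝ≥0∞) (z₀ : E × E) :
    mixedNorm p q (fun z => F (z - z₀)) = mixedNorm p q F := by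
  have h : ∀ a, eLpNorm (fun b : E => F ((a, b) - z₀)) p volume =
      eLpNorm (fun b : E => F (a + -z₀.1, b)) p volume := fun a => by
    rw [← eLpNorm_comp_add volume (fun b : E => F (a + -z₀.1, b)) (-z₀.2)]
    simp [← sub_eq_add_neg]
    rfl
  unfold mixedNorm
  simp only [h]
  exact eLpNorm_comp_add volume (fun a => eLpNorm (fun b : E => F (a, b)) p volume) (-z₀.1) q

theorem mixedNorm_top_le {F : E × E → ℝ≥0∞} {C : ℝ≥0∞} (h : ∀ z, F z ≤ C) :
    mixedNorm ∞ ∞ F ≤ C := by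
  refine eLpNormEssSup_le_of_ae_enorm_bound (Eventually.of_forall fun a => ?_)
  rw [enorm_eq_self]
  exact eLpNormEssSup_le_of_ae_enorm_bound (Eventually.of_forall fun b => h (a, b))

/-- The inner essential supremum need not be continuous in `a`. Freezing `b` first leaves a
continuous function of `a`, whose supremum is bounded by monotonicity. -/
theorem le_mixedNorm_top {F : E × E → ℝ≥0∞} (hF : Continuous F) (z : E × E) :
    F z ≤ mixedNorm ∞ ∞ F := by
  simp only [mixedNorm, eLpNorm_exponent_top]
  have h1 : ∀ a b, F (a, b) ≤ eLpNormEssSup (fun b : E => F (a, b)) volume := fun a b =>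
    enorm_le_eLpNormEssSup (f := fun b => F (a, b)) (hF.comp (by fun_prop)) b
  have h2 : ∀ b : E, (⨆ a, F (a, b)) ≤
      eLpNormEssSup (fun a : E => eLpNormEssSup (fun b : E => F (a, b)) volume) volume := fun b => by
    rw [← eLpNormEssSup_eq_iSup (f := fun a => F (a, b)) (hF.comp (by fun_prop)) (μ := volume),
      ← eLpNorm_exponent_top, ← eLpNorm_exponent_top]
    exact eLpNorm_mono_enorm fun a => by simpa using h1 a b
  exact (le_iSup (fun a => F (a, z.2)) z.1).trans (h2 z.2)

/-- **Hölder's inequality.** -/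
theorem exists_lintegral_mul_le {p : ℝ≥0∞} (hp : 1 ≤ p) : ∃ p' : ℝ≥0∞,
    1 ≤ p' ∧ ∀ {X : Type} [MeasurableSpace X] {μ : Measure X} {f k : X → ℝ≥0∞},
      Measurable f → Measurable k → ∫⁻ x, f x * k x ∂μ ≤ eLpNorm f p μ * eLpNorm k p' μ := by
  rcases eq_or_ne p ∞ with rfl | hp'
  · refine ⟨1, le_rfl, fun {X} _ {μ f k} hf hk => ?_⟩
    rw [eLpNorm_one_eq_lintegral_enorm, ← lintegral_const_mul _ (by simpa using hk)]
    refine lintegral_mono_ae ?_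
    filter_upwards [enorm_ae_le_eLpNormEssSup f μ] with x hx
    rw [eLpNorm_exponent_top, enorm_eq_self] at *
    gcongr
  rcases hp.eq_or_lt with rfl | hp1
  · refine ⟨∞, le_top, fun {X} _ {μ f k} hf hk => ?_⟩
    rw [eLpNorm_one_eq_lintegral_enorm, ← lintegral_mul_const _ (by simpa using hf)]
    refine lintegral_mono_ae ?_
    filter_upwards [enorm_ae_le_eLpNormEssSup k μ] with x hx
    rw [eLpNorm_exponent_top, enorm_eq_self] at *
    gcongr
  have h1 : 1 < p.toReal := by
    rw [← ENNReal.toReal_one]; exact (ENNReal.toReal_lt_toReal (by simp) hp').2 hp1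
  have hc := Real.HolderConjugate.conjExponent h1
  refine ⟨ENNReal.ofReal p.toReal.conjExponent, by simpa using hc.symm.lt.le,
    fun {X} _ {μ f k} hf hk => ?_⟩
  rw [eLpNorm_eq_lintegral_rpow_enorm_toReal (zero_lt_one.trans hp1).ne' hp',
    eLpNorm_eq_lintegral_rpow_enorm_toReal (by simpa using hc.symm.pos) ENNReal.ofReal_ne_top,
    ENNReal.toReal_ofReal hc.symm.pos.le]
  simpa using ENNReal.lintegral_mul_le_Lp_mul_Lq μ hc hf.aemeasurable hk.aemeasurable

/-- **Hölder's inequality** for mixed norms. -/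
theorem exists_lintegral_mul_le_mixedNorm {p q : ℝ≥0∞} (hp : 1 ≤ p) (hq : 1 ≤ q) :
    ∃ p' q' : ℝ≥0∞, 1 ≤ p' ∧ 1 ≤ q' ∧ ∀ {F K : E × E → ℝ≥0∞}, Continuous F → Continuous K →
      ∫⁻ z, F z * K z ≤ mixedNorm p q F * mixedNorm p' q' K := by
  obtain ⟨p', hp', hP⟩ := exists_lintegral_mul_le hp
  obtain ⟨q', hq', hQ⟩ := exists_lintegral_mul_le hq
  refine ⟨p', q', hp', hq', fun {F K} hF hK => ?_⟩
  rw [Measure.volume_eq_prod, lintegral_prod (fun z => F z * K z) (hF.measurable.mul hK.measurable).aemeasurable]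
  refine le_trans (lintegral_mono fun a => ?_) (hQ (μ := volume)
    (f := fun a : E => eLpNorm (fun b : E => F (a, b)) p volume)
    (k := fun a : E => eLpNorm (fun b : E => K (a, b)) p' volume)
    (measurable_eLpNorm_slice hF hF.measurable hp) (measurable_eLpNorm_slice hK hK.measurable hp'))
  exact hP (hF.measurable.comp measurable_prodMk_left) (hK.measurable.comp measurable_prodMk_left)

theorem mixedNorm_schwartz_lt_top (Θ : 𝓢(E × E, ℂ)) (p q : ℝ≥0∞) :
    mixedNorm p q (fun z => ‖Θ z‖ₑ) < ∞ := by
  obtain ⟨k, hk⟩ := (inferInstance : (volume : Measure E).HasTemperateGrowth).exists_eLpNorm_lt_top p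
  obtain ⟨l, hl⟩ := (inferInstance : (volume : Measure E).HasTemperateGrowth).exists_eLpNorm_lt_top q
  set C : ℝ := 2 ^ (k + l) * ((Finset.Iic (k + l, 0)).sup fun m =>
    SchwartzMap.seminorm ℝ m.1 m.2) Θ with hC
  -- Decay of order `k + l` in the pair yields decay `k` in `b` and `l` in `a`, enough for finite
  -- `p`- and `q`-norms respectively.
  have hC0 : 0 ≤ C := by positivity
  set N := eLpNorm (fun x : E => (1 + ‖x‖) ^ (-k : ℝ)) p volume with hN
  have h1 : ∀ a b : E, ‖Θ (a, b)‖ ≤ C * (1 + ‖a‖) ^ (-l : ℝ) * (1 + ‖b‖) ^ (-k : ℝ) := by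
    intro a b
    have h := SchwartzMap.one_add_le_sup_seminorm_apply (𝕜 := ℝ) (m := (k + l, 0)) le_rfl le_rfl
      Θ (a, b)
    rw [norm_iteratedFDeriv_zero] at h
    rw [Real.rpow_neg (by positivity), Real.rpow_neg (by positivity), Real.rpow_natCast,
      Real.rpow_natCast, ← div_eq_mul_inv, ← div_eq_mul_inv, div_div, le_div_iff₀ (by positivity)]
    refine le_trans ?_ h
    rw [mul_comm]
    gcongr
    rw [pow_add, mul_comm]
    gcongr
    · exact le_max_right _ _
    · exact le_max_left _ _
  have h2 : ∀ a : E, eLpNorm (fun b : E => ‖Θ (a, b)‖ₑ) p volume ≤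
      ‖C * N.toReal * (1 + ‖a‖) ^ (-l : ℝ)‖ₑ := by
    intro a
    have h3 : eLpNorm (fun b : E => ‖Θ (a, b)‖ₑ) p volume ≤
        eLpNorm ((C * (1 + ‖a‖) ^ (-l : ℝ)) • fun b : E => (1 + ‖b‖) ^ (-k : ℝ)) p volume := by
      rw [eLpNorm_enorm]
      refine eLpNorm_mono_real fun b => ?_
      simpa using h1 a b
    refine h3.trans (le_of_eq ?_)
    have h4 : N = ‖N.toReal‖ₑ := by
      rw [Real.enorm_of_nonneg ENNReal.toReal_nonneg, ENNReal.ofReal_toReal hk.ne]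
    rw [eLpNorm_const_smul, ← hN, mul_right_comm C N.toReal, enorm_mul _ N.toReal, ← h4]
  calc mixedNorm p q (fun z => ‖Θ z‖ₑ)
      ≤ eLpNorm ((C * N.toReal) • fun a : E => (1 + ‖a‖) ^ (-l : ℝ)) q volume :=
        eLpNorm_mono_enorm fun a => by simpa using h2 a
    _ < ∞ := by
        rw [eLpNorm_const_smul]
        exact ENNReal.mul_lt_top enorm_lt_top hl

theorem continuous_enorm_stft (g : 𝓢(E, ℂ)) (u : 𝓢'(E, ℂ)) :
    Continuous fun z : E × E => ‖stft g u z.2 z.1‖ₑ := (continuous_stft g u).enorm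

/-- The triangle inequality in the inversion formula. It is the device by which estimates on
time-frequency shifts of `g` pass to arbitrary test functions. -/
theorem enorm_bracket_le {g : 𝓢(E, ℂ)} (hg : g ≠ 0) (u : 𝓢'(E, ℂ)) (h : 𝓢(E, ℂ)) :
    ‖bracket u h‖ₑ ≤ ENNReal.ofReal (normSq g)⁻¹ *
      ∫⁻ z : E × E, ‖stft g u z.2 z.1‖ₑ * ‖stftS g h z‖ₑ := by
  have hn := normSq_pos hg
  have h1 : bracket u h = ((normSq g)⁻¹ : ℝ) *
      ∫ z : E × E, conj (stftS g h z) * stft g u z.2 z.1 := by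
    rw [← normSq_mul_bracket, ← mul_assoc, ← Complex.ofReal_mul, inv_mul_cancel₀ hn.ne']
    simp
  rw [h1, enorm_mul]
  gcongr
  · rw [← ofReal_norm, Complex.norm_real, Real.norm_of_nonneg (by positivity)]
  · refine (enorm_integral_le_lintegral_enorm _).trans (le_of_eq (lintegral_congr fun z => ?_))
    rw [enorm_mul, RCLike.enorm_conj, mul_comm]

theorem enorm_stftS_tfShift (g φ : 𝓢(E, ℂ)) (x ω : E) (z : E × E) :
    ‖stftS g (tfShift x ω φ) z‖ₑ = ‖stftS g φ (z - (ω, x))‖ₑ := by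
  rw [← ofReal_norm, norm_stftS_tfShift, ofReal_norm]
  rfl

/-- Every modulation space is contained in `M^{∞,∞}`. -/
theorem modSpace_subset_top {g : 𝓢(E, ℂ)} (hg : g ≠ 0) {p q : ℝ≥0∞} (hp : 1 ≤ p) (hq : 1 ≤ q) :
    modSpace g p q ⊆ modSpace g ∞ ∞ := by
  intro u hu
  rw [modSpace, Set.mem_ofPred_eq, modNorm_eq_mixedNorm] at *
  obtain ⟨p', q', -, -, h⟩ := exists_lintegral_mul_le_mixedNorm (ι := ι) hp hq
  refine (mixedNorm_top_le (C := ENNReal.ofReal (normSq g)⁻¹ *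
    (mixedNorm p q (fun z => ‖stft g u z.2 z.1‖ₑ) *
      mixedNorm p' q' fun z => ‖stftS g g z‖ₑ)) fun w => ?_).trans_lt ?_
  · refine (enorm_bracket_le hg u _).trans ?_
    gcongr
    simp only [enorm_stftS_tfShift]
    -- Hölder is applied to a translate of `V_g g`; translation invariance makes the bound uniform
    -- in `w`.
    rw [← mixedNorm_comp_sub (fun z => ‖stftS g g z‖ₑ) (w.1, w.2)]
    exact h (continuous_enorm_stft g u)
      ((stftS g g).continuous.comp (continuous_id.sub continuous_const)).enorm
  · exact ENNReal.mul_lt_top ENNReal.ofReal_lt_top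
      (ENNReal.mul_lt_top hu (mixedNorm_schwartz_lt_top _ _ _))

/-- Convolution-type operators with an integrable kernel are bounded on mixed-norm spaces. -/
theorem exists_mixedNorm_lintegral_le (L₁ L₂ M₁ M₂ : E ≃L[ℝ] E) :
    ∃ C : ℝ≥0, ∀ (p q : ℝ≥0∞), 1 ≤ p → 1 ≤ q → ∀ (F h : E × E → ℝ≥0∞), Continuous F →
      Measurable h →
      mixedNorm p q (fun w => ∫⁻ z : E × E, F z * h (L₁ w.1 + M₁ z.1, L₂ w.2 + M₂ z.2)) ≤
        C * (∫⁻ z, h z) * mixedNorm p q F := by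
  obtain ⟨c, hc⟩ := exists_lintegral_comp_eq (volume : Measure (E × E)) (volume : Measure (E × E))
    (M₁.prodCongr M₂)
  obtain ⟨c₁, hc₁⟩ := exists_eLpNorm_comp_le (volume : Measure E) (volume : Measure E)
    ((L₁.trans M₁.symm).trans (ContinuousLinearEquiv.neg ℝ))
  obtain ⟨c₂, hc₂⟩ := exists_eLpNorm_comp_le (volume : Measure E) (volume : Measure E)
    ((L₂.trans M₂.symm).trans (ContinuousLinearEquiv.neg ℝ))
  refine ⟨c * c₁ * c₂, fun p q hp hq F h hF hh => ?_⟩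
  set N := fun a : E => eLpNorm (fun b : E => F (a, b)) p volume with hN
  have hNm : Measurable N := measurable_eLpNorm_slice hF hF.measurable hp
  -- After the substitution `s = (L₁ w₁ + M₁ z₁, L₂ w₂ + M₂ z₂)` the operator averages translates of
  -- `F`, composed with an invertible map in each variable, against `ν`. Minkowski is then used once
  -- per variable.
  set ν := (c : ℝ≥0∞) • (volume : Measure (E × E)).withDensity h with hν
  have h1 : ∀ w : E × E, ∫⁻ z : E × E, F z * h (L₁ w.1 + M₁ z.1, L₂ w.2 + M₂ z.2) =
      ∫⁻ s, F (-M₁.symm (L₁ w.1) + M₁.symm s.1, -M₂.symm (L₂ w.2) + M₂.symm s.2) ∂ν := by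
    intro w
    rw [hν, lintegral_smul_measure, lintegral_withDensity_eq_lintegral_mul _ hh
      (g := fun s => F (-M₁.symm (L₁ w.1) + M₁.symm s.1, -M₂.symm (L₂ w.2) + M₂.symm s.2))
      (hF.comp (by fun_prop)).measurable, smul_eq_mul, ← hc _ (L₁ w.1, L₂ w.2)]
    refine lintegral_congr fun z => ?_
    simp [add_comm, mul_comm]
  have hνt : ν Set.univ = c * ∫⁻ z, h z := by
    rw [hν, Measure.smul_apply, withDensity_apply _ MeasurableSet.univ, setLIntegral_univ,
      smul_eq_mul]
  rw [funext h1]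
  have h2 : ∀ a : E, eLpNorm (fun b : E => ∫⁻ s : E × E,
      F (-M₁.symm (L₁ a) + M₁.symm s.1, -M₂.symm (L₂ b) + M₂.symm s.2) ∂ν) p volume ≤
      ∫⁻ s : E × E, c₂ * N (-M₁.symm (L₁ a) + M₁.symm s.1) ∂ν := by
    intro a
    have hcont : Continuous fun z : (E × E) × E =>
      F (-M₁.symm (L₁ a) + M₁.symm z.1.1, -M₂.symm (L₂ z.2) + M₂.symm z.1.2) :=
      hF.comp (by fun_prop)
    refine (eLpNorm_lintegral_le (μ := (volume : Measure E)) (ν := ν) (f := fun z : E × (E × E) =>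
      F (-M₁.symm (L₁ a) + M₁.symm z.2.1, -M₂.symm (L₂ z.1) + M₂.symm z.2.2))
      (hF.comp (by fun_prop)).measurable hp
      (measurable_eLpNorm_slice hcont hcont.measurable hp)).trans
      (lintegral_mono fun s => ?_)
    exact hc₂ (fun b => F (-M₁.symm (L₁ a) + M₁.symm s.1, b)) (M₂.symm s.2) p hp
  have h3 : ∀ s : E × E, eLpNorm (fun a : E => c₂ * N (-M₁.symm (L₁ a) + M₁.symm s.1)) q volume =
      eLpNorm (fun a : E => c₂ * N (-M₁.symm (L₁ a))) q volume := by
    intro s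
    rw [← eLpNorm_comp_add volume (fun a : E => c₂ * N (-M₁.symm (L₁ a))) (-L₁.symm s.1)]
    simp [add_comm]
  have h4 : eLpNorm (fun a : E => c₂ * N (-M₁.symm (L₁ a))) q volume ≤
      c₁ * c₂ * eLpNorm N q volume := by
    have := hc₁ (fun a => c₂ * N a) 0 q hq
    simp only [add_zero] at this
    refine this.trans ?_
    rw [mul_assoc]
    gcongr
    exact eLpNorm_le_nnreal_smul_eLpNorm_of_ae_le_mul'
      (Eventually.of_forall fun a => by simp) q
  calc eLpNorm (fun a : E => eLpNorm (fun b : E => ∫⁻ s : E × E,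
        F (-M₁.symm (L₁ a) + M₁.symm s.1, -M₂.symm (L₂ b) + M₂.symm s.2) ∂ν) p volume) q volume
      ≤ eLpNorm (fun a : E => ∫⁻ s : E × E, c₂ * N (-M₁.symm (L₁ a) + M₁.symm s.1) ∂ν) q volume :=
        eLpNorm_mono_enorm fun a => by simpa using h2 a
    _ ≤ ∫⁻ s : E × E, eLpNorm (fun a : E => c₂ * N (-M₁.symm (L₁ a) + M₁.symm s.1)) q volume ∂ν := by
        refine eLpNorm_lintegral_le (μ := (volume : Measure E)) (ν := ν)
          (f := fun z : E × (E × E) => c₂ * N (-M₁.symm (L₁ z.1) + M₁.symm z.2.1)) ?_ hq ?_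
        · exact (hNm.comp (by fun_prop)).const_mul _
        · simp only [h3]; exact measurable_const
    _ ≤ ∫⁻ _ : E × E, c₁ * c₂ * eLpNorm N q volume ∂ν :=
        lintegral_mono fun s => (h3 s).trans_le h4
    _ = c * c₁ * c₂ * (∫⁻ z, h z) * eLpNorm N q volume := by rw [lintegral_const, hνt]; ring

end MixedNorm

/-! ### Change of window in the Sjöstrand class. -/

section Majorant

variable {ι : Type} [Fintype ι]

local notation "E" => EuclideanSpace ℝ ι

/-- Elements of the Sjöstrand class have short-time Fourier transforms, for every window, that
are dominated by an integrable function of the frequency variable. -/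
theorem exists_majorant_stft {G : 𝓢(E, ℂ)} (hG : G ≠ 0) (Φ : 𝓢(E, ℂ)) :
    ∃ C : ℝ≥0, ∀ σ : 𝓢'(E, ℂ), ∃ H : E → ℝ≥0∞, Measurable H ∧
      (∀ X Ω, ‖stft Φ σ X Ω‖ₑ ≤ H Ω) ∧ ∫⁻ Ω, H Ω ≤ C * modNorm G ∞ 1 σ := by
  set k : E → ℝ≥0∞ := fun Ω => ∫⁻ X, ‖stftS G Φ (Ω, X)‖ₑ with hk
  have hm : Measurable fun z : E × E => ‖stftS G Φ z‖ₑ :=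
    (stftS G Φ).continuous.enorm.measurable
  have hkm : Measurable k := hm.lintegral_prod_right'
  have hkint : ∫⁻ Ω, k Ω = ∫⁻ z : E × E, ‖stftS G Φ z‖ₑ := by
    rw [Measure.volume_eq_prod, lintegral_prod _ hm.aemeasurable]
  have hfin : ∫⁻ Ω, k Ω < ∞ := by
    rw [hkint]; exact ((stftS G Φ).integrable (μ := volume)).2
  refine ⟨(ENNReal.ofReal (normSq G)⁻¹ * ∫⁻ Ω, k Ω).toNNReal, fun σ => ?_⟩
  rw [ENNReal.coe_toNNReal (ENNReal.mul_ne_top ENNReal.ofReal_ne_top hfin.ne)]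
  set S : E → ℝ≥0∞ := fun Ω => eLpNormEssSup (fun X : E => ‖stft G σ X Ω‖ₑ) volume with hS
  have hSm : Measurable S := measurable_eLpNormEssSup
    (F := fun z : E × E => ‖stft G σ z.2 z.1‖ₑ) (continuous_enorm_stft G σ)
  have hSle : ∀ Ω X, ‖stft G σ X Ω‖ₑ ≤ S Ω := fun Ω X => by
    have hc : Continuous fun X : E => ‖stft G σ X Ω‖ₑ :=
      (continuous_enorm_stft G σ).comp (g := fun z : E × E => ‖stft G σ z.2 z.1‖ₑ)
        (f := fun X : E => (Ω, X)) (by fun_prop)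
    exact enorm_le_eLpNormEssSup (μ := volume) hc X
  have hSint : modNorm G ∞ 1 σ = ∫⁻ Ω, S Ω := by
    rw [modNorm_eq_mixedNorm, mixedNorm, eLpNorm_one_eq_lintegral_enorm]
    simp only [hS, eLpNorm_exponent_top, enorm_eq_self]
  have hjoint : Measurable fun z : E × E => S z.2 * k (z.2 - z.1) :=
    (hSm.comp measurable_snd).mul (hkm.comp (measurable_snd.sub measurable_fst))
  -- Changing the window from `G` to `Φ` correlates `S`, whose integral is the Sjöstrand norm, with
  -- the integrable function `k`; Tonelli gives the product of the two integrals.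
  refine ⟨fun Ω => ENNReal.ofReal (normSq G)⁻¹ * ∫⁻ Ω', S Ω' * k (Ω' - Ω),
    hjoint.lintegral_prod_right'.const_mul _, fun X Ω => ?_, ?_⟩
  · refine (enorm_bracket_le hG σ _).trans ?_
    refine mul_le_mul_right ?_ _
    simp only [enorm_stftS_tfShift]
    rw [Measure.volume_eq_prod, lintegral_prod]
    · refine lintegral_mono fun Ω' => ?_
      calc ∫⁻ X', ‖stft G σ X' Ω'‖ₑ * ‖stftS G Φ ((Ω', X') - (Ω, X))‖ₑ
          ≤ ∫⁻ X', S Ω' * ‖stftS G Φ (Ω' - Ω, X' - X)‖ₑ :=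
            lintegral_mono fun X' => mul_le_mul_left (hSle Ω' X') _
        _ = S Ω' * ∫⁻ X', ‖stftS G Φ (Ω' - Ω, X' - X)‖ₑ :=
            lintegral_const_mul _ (hm.comp (by fun_prop))
        _ = S Ω' * k (Ω' - Ω) := by
            rw [lintegral_sub_right_eq_self (fun X' => ‖stftS G Φ (Ω' - Ω, X')‖ₑ) X]
    · exact ((continuous_enorm_stft G σ).measurable.mul (hm.comp (by fun_prop))).aemeasurable
  · rw [lintegral_const_mul _ hjoint.lintegral_prod_right', hSint,
      lintegral_lintegral_swap (f := fun Ω Ω' => S Ω' * k (Ω' - Ω)) hjoint.aemeasurable, mul_assoc]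
    gcongr
    refine le_of_eq ?_
    calc ∫⁻ Ω', ∫⁻ Ω, S Ω' * k (Ω' - Ω) = ∫⁻ Ω', S Ω' * ∫⁻ Ω, k Ω := by
          refine lintegral_congr fun Ω' => ?_
          rw [lintegral_const_mul (f := fun Ω => k (Ω' - Ω)) _ (hkm.comp (by fun_prop)),
            lintegral_sub_left_eq_self k Ω']
      _ = (∫⁻ Ω, k Ω) * ∫⁻ Ω, S Ω := by
          rw [lintegral_mul_const _ hSm, mul_comm]

end Majorant

/-! ### The Gabor matrix of the operator. -/

section Kernel

variable {d : ℕ}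

local notation "E" => EuclideanSpace ℝ (Fin d)
local notation "E₂" => EuclideanSpace ℝ (Fin d ⊕ Fin d)

/-- The action of an invertible matrix as a continuous linear equivalence. -/
def matEquiv (B : Matrix (Fin d) (Fin d) ℝ) (hB : IsUnit B) : E ≃L[ℝ] E :=
  ContinuousLinearEquiv.equivOfInverse (matCLM B) (matCLM B⁻¹)
    (fun x => by
      rw [matCLM_apply, matCLM_apply, matAct_matAct,
        Matrix.nonsing_inv_mul B ((Matrix.isUnit_iff_isUnit_det B).1 hB), matAct_one])
    (fun x => by
      rw [matCLM_apply, matCLM_apply, matAct_matAct,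
        Matrix.mul_nonsing_inv B ((Matrix.isUnit_iff_isUnit_det B).1 hB), matAct_one])

theorem matEquiv_apply (B : Matrix (Fin d) (Fin d) ℝ) (hB : IsUnit B) (x : E) :
    matEquiv B hB x = matAct B x := rfl

theorem matAct_neg (B : Matrix (Fin d) (Fin d) ℝ) (x : E) : matAct (-B) x = -matAct B x := by
  ext i; simp [matAct, Matrix.neg_mulVec]

/-- If `A` is left-regular, the lower blocks of `A⁻¹` are invertible. -/
theorem isUnit_inv_blocks {A : Matrix (Fin d ⊕ Fin d) (Fin d ⊕ Fin d) ℝ} (hA : IsUnit A)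
    (hreg : IsBlockLeftRegular A) : IsUnit A⁻¹.toBlocks₂₁ ∧ IsUnit A⁻¹.toBlocks₂₂ := by
  obtain ⟨-, -, h21, h22⟩ := blocks_of_mul_eq_one
    (Matrix.nonsing_inv_mul A ((Matrix.isUnit_iff_isUnit_det A).1 hA))
  -- The lower left block of `A⁻¹ A = 1` expresses each lower block of `A⁻¹` through the other.
  -- Inserted in the lower right block, this gives each one a right inverse, which suffices for
  -- square matrices.
  have e1 : A⁻¹.toBlocks₂₁ = -(A⁻¹.toBlocks₂₂ * A.toBlocks₂₁ * A.toBlocks₁₁⁻¹) := by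
    rw [← Matrix.neg_mul, ← eq_neg_of_add_eq_zero_left h21,
      Matrix.mul_nonsing_inv_cancel_right _ _ ((Matrix.isUnit_iff_isUnit_det _).1 hreg.1)]
  have e2 : A⁻¹.toBlocks₂₂ = -(A⁻¹.toBlocks₂₁ * A.toBlocks₁₁ * A.toBlocks₂₁⁻¹) := by
    rw [← Matrix.neg_mul, ← eq_neg_of_add_eq_zero_right h21,
      Matrix.mul_nonsing_inv_cancel_right _ _ ((Matrix.isUnit_iff_isUnit_det _).1 hreg.2)]
  constructor
  · rw [e2, neg_mul, mul_assoc, mul_assoc, ← sub_eq_add_neg, ← mul_sub] at h22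
    exact IsUnit.of_mul_eq_one _ h22
  · rw [e1, neg_mul, mul_assoc, mul_assoc, neg_add_eq_sub, ← mul_sub] at h22
    exact IsUnit.of_mul_eq_one _ h22

/-- The matrix coefficients of `σ^A` with respect to time-frequency shifts of `g` are dominated by
an integrable convolution-type kernel if `σ` belongs to the Sjöstrand class. -/
theorem exists_kernel_majorant {A : Matrix (Fin d ⊕ Fin d) (Fin d ⊕ Fin d) ℝ} (hA : IsUnit A)
    (hreg : IsBlockLeftRegular A) (g : 𝓢(E, ℂ)) {G : 𝓢(E₂, ℂ)} (hG : G ≠ 0) :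
    ∃ (L₁ L₂ M₁ M₂ : E ≃L[ℝ] E) (C : ℝ≥0), ∀ σ : 𝓢'(E₂, ℂ), ∃ k : E × E → ℝ≥0∞,
      Measurable k ∧ ∫⁻ z, k z ≤ C * modNorm G ∞ 1 σ ∧ ∀ w z : E × E,
        ‖bracket σ (wignerS hA (tfShift w.2 w.1 g) (tfShift z.2 z.1 g))‖ₑ ≤
          k (L₁ w.1 + M₁ z.1, L₂ w.2 + M₂ z.2) := by
  obtain ⟨h21, h22⟩ := isUnit_inv_blocks hA hreg
  have h1 : IsUnit A.toBlocks₁₁ᵀ := (Matrix.isUnit_transpose _).2 hreg.1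
  have h2 : IsUnit (-A.toBlocks₂₁ᵀ) := ((Matrix.isUnit_transpose _).2 hreg.2).neg
  obtain ⟨C, hC⟩ := exists_majorant_stft hG (wignerS hA g g)
  obtain ⟨c, hc⟩ := exists_lintegral_comp_eq (volume : Measure (E × E)) (volume : Measure E₂)
    ((ContinuousLinearEquiv.prodComm ℝ E E).trans (halvesEquiv d).symm)
  -- These are the coefficients of the frequency point in `wignerS_tfShift`. Pairs are ordered `(ω,
  -- x)`, so the transposed blocks of `A` act on first components and the negated blocks of `A⁻¹` on
  -- second ones.
  refine ⟨matEquiv _ h1, matEquiv _ h21.neg, matEquiv _ h2, matEquiv _ h22.neg, c * C,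
    fun σ => ?_⟩
  obtain ⟨H, hHm, hHle, hHint⟩ := hC σ
  have hint := hc H 0
  simp only [add_zero] at hint
  refine ⟨_, hHm.comp (ContinuousLinearEquiv.continuous _).measurable, hint.trans_le ?_,
    fun w z => ?_⟩
  · rw [ENNReal.coe_mul, mul_assoc]
    gcongr
  · rw [← ofReal_norm, norm_bracket_wignerS_tfShift, ofReal_norm]
    refine (hHle _ _).trans (le_of_eq ?_)
    simp only [matEquiv_apply, matAct_neg, Function.comp_apply]
    rw [← sub_eq_add_neg, ← neg_add]
    rfl

end Kernel

/-! ### Elementary properties of `M^∞` and of Schwartz functions in modulation spaces. -/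

section General

variable {ι : Type} [Fintype ι]

local notation "E" => EuclideanSpace ℝ ι

theorem stft_add (g : 𝓢(E, ℂ)) (u v : 𝓢'(E, ℂ)) (x ω : E) :
    stft g (u + v) x ω = stft g u x ω + stft g v x ω := rfl

theorem stft_smul (g : 𝓢(E, ℂ)) (c : ℂ) (u : 𝓢'(E, ℂ)) (x ω : E) :
    stft g (c • u) x ω = c * stft g u x ω := rfl

theorem enorm_stft_le_modNorm_top (g : 𝓢(E, ℂ)) (u : 𝓢'(E, ℂ)) (z : E × E) :
    ‖stft g u z.2 z.1‖ₑ ≤ modNorm g ∞ ∞ u := by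
  rw [modNorm_eq_mixedNorm]
  exact le_mixedNorm_top (continuous_enorm_stft g u) z

theorem mem_modSpace_top_of_bound {g : 𝓢(E, ℂ)} {u : 𝓢'(E, ℂ)} {R : ℝ≥0}
    (h : ∀ z : E × E, ‖stft g u z.2 z.1‖ₑ ≤ R) : u ∈ modSpace g ∞ ∞ := by
  rw [modSpace, Set.mem_ofPred_eq, modNorm_eq_mixedNorm]
  exact (mixedNorm_top_le h).trans_lt ENNReal.coe_lt_top

theorem add_mem_modSpace_top {g : 𝓢(E, ℂ)} {u v : 𝓢'(E, ℂ)} (hu : u ∈ modSpace g ∞ ∞)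
    (hv : v ∈ modSpace g ∞ ∞) : u + v ∈ modSpace g ∞ ∞ := by
  lift modNorm g ∞ ∞ u to ℝ≥0 using hu.ne with R hR
  lift modNorm g ∞ ∞ v to ℝ≥0 using hv.ne with S hS
  refine mem_modSpace_top_of_bound (R := R + S) fun z => ?_
  rw [stft_add, ENNReal.coe_add, hR, hS]
  exact (enorm_add_le _ _).trans
    (add_le_add (enorm_stft_le_modNorm_top g u z) (enorm_stft_le_modNorm_top g v z))

theorem smul_mem_modSpace_top {g : 𝓢(E, ℂ)} {u : 𝓢'(E, ℂ)} (c : ℂ) (hu : u ∈ modSpace g ∞ ∞) :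
    c • u ∈ modSpace g ∞ ∞ := by
  lift modNorm g ∞ ∞ u to ℝ≥0 using hu.ne with R hR
  refine mem_modSpace_top_of_bound (R := ‖c‖₊ * R) fun z => ?_
  rw [stft_smul, ENNReal.coe_mul, hR, enorm_mul]
  exact mul_le_mul_right (enorm_stft_le_modNorm_top g u z) _

theorem stft_toTemperedDistribution (g f : 𝓢(E, ℂ)) (z : E × E) :
    stft g (SchwartzMap.toTemperedDistributionCLM E ℂ volume f) z.2 z.1 = stftS g f z := by
  rw [stft, bracket, stftS_apply]
  simp [conjS_apply, mul_comm]

theorem toTemperedDistribution_mem_modSpace (g f : 𝓢(E, ℂ)) (p q : ℝ≥0∞) :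
    SchwartzMap.toTemperedDistributionCLM E ℂ volume f ∈ modSpace g p q := by
  rw [modSpace, Set.mem_ofPred_eq, modNorm_eq_mixedNorm]
  simp only [stft_toTemperedDistribution]
  exact mixedNorm_schwartz_lt_top _ p q

end General

/-! ### The extension to `M^∞` and its boundedness. -/

section Extension

variable {d : ℕ}

local notation "E" => EuclideanSpace ℝ (Fin d)
local notation "E₂" => EuclideanSpace ℝ (Fin d ⊕ Fin d)

variable {A : Matrix (Fin d ⊕ Fin d) (Fin d ⊕ Fin d) ℝ} {hA : IsUnit A}
  {g : 𝓢(EuclideanSpace ℝ (Fin d), ℂ)} {σ : 𝓢'(EuclideanSpace ℝ (Fin d ⊕ Fin d), ℂ)}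

/-- The matrix coefficients of `σ^A` are integrable in the second argument. -/
def HasSummableCoefficients (hA : IsUnit A) (g : 𝓢(E, ℂ)) (σ : 𝓢'(E₂, ℂ)) : Prop :=
  ∃ D : ℝ≥0, ∀ h : 𝓢(E, ℂ),
    ∫⁻ z : E × E, ‖bracket σ (wignerS hA h (tfShift z.2 z.1 g))‖ₑ ≤
      D * ∫⁻ z : E × E, ‖stftS g h z‖ₑ

theorem continuous_coefficient (hA : IsUnit A) (g : 𝓢(E, ℂ)) (σ : 𝓢'(E₂, ℂ)) (h : 𝓢(E, ℂ)) :
    Continuous fun z : E × E => bracket σ (wignerS hA h (tfShift z.2 z.1 g)) := by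
  simp only [← matrixOpForm_apply]
  exact (matrixOpForm hA σ h).continuous.comp (continuous_tfShift g)

/-- Expanding `h` by the inversion formula bounds its coefficient by the integral of the kernel
against `|V_g h|`. Integrating over `z` first, the kernel contributes a constant independent of `w`.
-/
theorem HasSummableCoefficients.of_majorant (hg : g ≠ 0) {L₁ L₂ M₁ M₂ : E ≃L[ℝ] E}
    {k : E × E → ℝ≥0∞} (hk : Measurable k) (hkint : ∫⁻ z, k z ≠ ∞)
    (hle : ∀ w z : E × E, ‖bracket σ (wignerS hA (tfShift w.2 w.1 g) (tfShift z.2 z.1 g))‖ₑ ≤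
      k (L₁ w.1 + M₁ z.1, L₂ w.2 + M₂ z.2)) : HasSummableCoefficients hA g σ := by
  obtain ⟨c, hc⟩ := exists_lintegral_comp_eq (volume : Measure (E × E)) (volume : Measure (E × E))
    (M₁.prodCongr M₂)
  refine ⟨(ENNReal.ofReal (normSq g)⁻¹ * (c * ∫⁻ z, k z)).toNNReal, fun h => ?_⟩
  rw [ENNReal.coe_toNNReal (by finiteness)]
  have hV : Measurable fun w : E × E => ‖stftS g h w‖ₑ := (stftS g h).continuous.enorm.measurable
  have h1 : ∀ z : E × E, ‖bracket σ (wignerS hA h (tfShift z.2 z.1 g))‖ₑ ≤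
      ENNReal.ofReal (normSq g)⁻¹ *
        ∫⁻ w : E × E, k (L₁ w.1 + M₁ z.1, L₂ w.2 + M₂ z.2) * ‖stftS g h w‖ₑ := by
    intro z
    rw [← bracket_matrixOpS]
    refine (enorm_bracket_le hg _ h).trans (mul_le_mul_right (lintegral_mono fun w => ?_) _)
    refine mul_le_mul_left ?_ _
    rw [stft, bracket_matrixOpS]
    exact hle w z
  have hm : Measurable fun y : (E × E) × (E × E) =>
      k (L₁ y.2.1 + M₁ y.1.1, L₂ y.2.2 + M₂ y.1.2) * ‖stftS g h y.2‖ₑ :=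
    (hk.comp (by fun_prop)).mul (hV.comp measurable_snd)
  calc ∫⁻ z : E × E, ‖bracket σ (wignerS hA h (tfShift z.2 z.1 g))‖ₑ
      ≤ ∫⁻ z : E × E, ENNReal.ofReal (normSq g)⁻¹ *
        ∫⁻ w : E × E, k (L₁ w.1 + M₁ z.1, L₂ w.2 + M₂ z.2) * ‖stftS g h w‖ₑ := lintegral_mono h1
    _ = ENNReal.ofReal (normSq g)⁻¹ * ∫⁻ w : E × E, ∫⁻ z : E × E,
          k (L₁ w.1 + M₁ z.1, L₂ w.2 + M₂ z.2) * ‖stftS g h w‖ₑ := by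
        rw [lintegral_const_mul _ hm.lintegral_prod_right', lintegral_lintegral_swap
          (f := fun z w : E × E => k (L₁ w.1 + M₁ z.1, L₂ w.2 + M₂ z.2) * ‖stftS g h w‖ₑ)
          hm.aemeasurable]
    _ = ENNReal.ofReal (normSq g)⁻¹ * ∫⁻ w : E × E, (c * ∫⁻ z, k z) * ‖stftS g h w‖ₑ := by
        congr 1
        refine lintegral_congr fun w => ?_
        rw [lintegral_mul_const (f := fun z : E × E => k (L₁ w.1 + M₁ z.1, L₂ w.2 + M₂ z.2)) _
          (hk.comp (by fun_prop)), ← hc k (L₁ w.1, L₂ w.2)]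
        congr 1
        refine lintegral_congr fun z => ?_
        simp [add_comm]
    _ = _ := by rw [lintegral_const_mul _ hV]; simp only [mul_assoc]

theorem HasSummableCoefficients.integrable (hσ : HasSummableCoefficients hA g σ) (h : 𝓢(E, ℂ)) :
    Integrable fun z : E × E => bracket σ (wignerS hA h (tfShift z.2 z.1 g)) := by
  obtain ⟨D, hD⟩ := hσ
  refine ⟨(continuous_coefficient hA g σ h).aestronglyMeasurable, (hD h).trans_lt ?_⟩
  exact ENNReal.mul_lt_top ENNReal.coe_lt_top ((stftS g h).integrable (μ := volume)).2

theorem norm_stft_le_toReal {u : 𝓢'(E, ℂ)} (hu : u ∈ modSpace g ∞ ∞) (z : E × E) :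
    ‖stft g u z.2 z.1‖ ≤ (modNorm g ∞ ∞ u).toReal := by
  rw [← toReal_enorm]
  exact ENNReal.toReal_mono (ne_of_lt hu) (enorm_stft_le_modNorm_top g u z)

theorem HasSummableCoefficients.integrable_mul (hσ : HasSummableCoefficients hA g σ)
    {u : 𝓢'(E, ℂ)} (hu : u ∈ modSpace g ∞ ∞) (h : 𝓢(E, ℂ)) :
    Integrable fun z : E × E =>
      stft g u z.2 z.1 * bracket σ (wignerS hA h (tfShift z.2 z.1 g)) :=
  (hσ.integrable h).bdd_mul (continuous_stft g u).aestronglyMeasurable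
    (Eventually.of_forall (norm_stft_le_toReal hu))

/-- The operator `σ^A` on `M^∞`, by its matrix coefficients. -/
theorem HasSummableCoefficients.exists_apply (hσ : HasSummableCoefficients hA g σ)
    {u : 𝓢'(E, ℂ)} (hu : u ∈ modSpace g ∞ ∞) :
    ∃ v : 𝓢'(E, ℂ), ∀ φ : 𝓢(E, ℂ), v φ = ((normSq g)⁻¹ : ℝ) * ∫ z : E × E,
      stft g u z.2 z.1 * bracket σ (wignerS hA (conjS φ) (tfShift z.2 z.1 g)) := by
  set K : 𝓢(E, ℂ) → E × E → ℂ := fun φ z =>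
    bracket σ (wignerS hA (conjS φ) (tfShift z.2 z.1 g)) with hK
  have hKeq : ∀ φ z, K φ z = matrixOpS hA σ (tfShift z.2 z.1 g) φ := fun φ z => rfl
  have hint := fun φ : 𝓢(E, ℂ) => hσ.integrable_mul hu (conjS φ)
  let F : 𝓢(E, ℂ) →ₗ[ℂ] ℂ :=
    { toFun := fun φ => ((normSq g)⁻¹ : ℝ) * ∫ z : E × E, stft g u z.2 z.1 * K φ z
      map_add' := fun φ ψ => by
        rw [← mul_add, ← integral_add (hint φ) (hint ψ)]
        congr 2
        funext z
        rw [hKeq, map_add, mul_add]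
        rfl
      map_smul' := fun c φ => by
        rw [RingHom.id_apply, smul_eq_mul, mul_left_comm, ← integral_const_mul c]
        congr 2
        funext z
        rw [hKeq, map_smul, smul_eq_mul, mul_left_comm]
        rfl }
  have hF : Continuous F := by
    have hσ' := hσ
    obtain ⟨D, hD⟩ := hσ
    -- The functional is bounded by a multiple of the `L¹` norm of `V_g (conjS φ)`, which depends
    -- continuously on `φ` and vanishes at `0`; a linear map continuous at `0` is continuous.
    set P : 𝓢(E, ℂ) → ℝ := fun φ => (normSq g)⁻¹ * ((modNorm g ∞ ∞ u).toReal *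
      (D * ‖(stftS g (conjS φ)).toLp 1 (volume : Measure (E × E))‖)) with hP
    have hPc : Continuous P := by
      have : Continuous fun φ : 𝓢(E, ℂ) =>
          (stftS g (conjS φ)).toLp 1 (volume : Measure (E × E)) :=
        SchwartzMap.continuous_toLp.comp ((stftS g).continuous.comp continuous_conjS)
      fun_prop
    have hP0 : P 0 = 0 := by
      have h0 : conjS (0 : 𝓢(E, ℂ)) = 0 := (conjCLM (Fin d)).map_zero
      simp [hP, h0, SchwartzMap.norm_toLp_one]
    have hbound : ∀ φ, ‖F φ‖ ≤ P φ := by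
      intro φ
      change ‖(((normSq g)⁻¹ : ℝ) : ℂ) * ∫ z : E × E, stft g u z.2 z.1 * K φ z‖ ≤ _
      have hn : 0 ≤ (normSq g)⁻¹ := inv_nonneg.2 (integral_nonneg fun t => by positivity)
      rw [norm_mul, Complex.norm_real, Real.norm_of_nonneg hn]
      refine mul_le_mul_of_nonneg_left ?_ hn
      calc ‖∫ z : E × E, stft g u z.2 z.1 * K φ z‖
          ≤ ∫ z : E × E, (modNorm g ∞ ∞ u).toReal * ‖K φ z‖ :=
            norm_integral_le_of_norm_le ((hσ'.integrable (conjS φ)).norm.const_mul _)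
              (Eventually.of_forall fun z => by
                rw [norm_mul]
                exact mul_le_mul_of_nonneg_right (norm_stft_le_toReal hu z) (norm_nonneg _))
        _ = (modNorm g ∞ ∞ u).toReal * ∫ z : E × E, ‖K φ z‖ := integral_const_mul _ _
        _ ≤ _ := by
            refine mul_le_mul_of_nonneg_left ?_ ENNReal.toReal_nonneg
            have hS := (stftS g (conjS φ)).integrable (μ := (volume : Measure (E × E)))
            rw [SchwartzMap.norm_toLp_one,
              integral_norm_eq_lintegral_enorm (hσ'.integrable (conjS φ)).1,
              integral_norm_eq_lintegral_enorm hS.1, ← ENNReal.coe_toReal, ← ENNReal.toReal_mul]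
            exact ENNReal.toReal_mono (ENNReal.mul_lt_top ENNReal.coe_lt_top hS.2).ne
              (hD (conjS φ))
    refine continuous_of_continuousAt_zero F ?_
    rw [ContinuousAt, map_zero]
    exact squeeze_zero_norm hbound (hP0 ▸ hPc.tendsto 0)
  exact ⟨ContinuousLinearMap.toUniformConvergenceCLM (RingHom.id ℂ) ℂ _ ⟨F, hF⟩, fun φ => rfl⟩

/-- The extension of `σ^A` to `M^∞`, by zero outside. -/
theorem HasSummableCoefficients.exists_extension (hσ : HasSummableCoefficients hA g σ) :
    ∃ T : 𝓢'(E, ℂ) → 𝓢'(E, ℂ), ∀ u ∈ modSpace g ∞ ∞, ∀ φ : 𝓢(E, ℂ),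
      T u φ = ((normSq g)⁻¹ : ℝ) * ∫ z : E × E,
        stft g u z.2 z.1 * bracket σ (wignerS hA (conjS φ) (tfShift z.2 z.1 g)) := by
  have h : ∀ u : 𝓢'(E, ℂ), ∃ v : 𝓢'(E, ℂ), u ∈ modSpace g ∞ ∞ → ∀ φ : 𝓢(E, ℂ),
      v φ = ((normSq g)⁻¹ : ℝ) * ∫ z : E × E,
        stft g u z.2 z.1 * bracket σ (wignerS hA (conjS φ) (tfShift z.2 z.1 g)) := by
    intro u
    by_cases hu : u ∈ modSpace g ∞ ∞
    · obtain ⟨v, hv⟩ := hσ.exists_apply hu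
      exact ⟨v, fun _ => hv⟩
    · exact ⟨0, fun h => absurd h hu⟩
  choose T hT using h
  exact ⟨T, hT⟩

theorem HasSummableCoefficients.isExtendedMatrixOp (hσ : HasSummableCoefficients hA g σ)
    (hg : g ≠ 0) {T : 𝓢'(E, ℂ) → 𝓢'(E, ℂ)}
    (hT : ∀ u ∈ modSpace g ∞ ∞, ∀ φ : 𝓢(E, ℂ),
      T u φ = ((normSq g)⁻¹ : ℝ) * ∫ z : E × E,
        stft g u z.2 z.1 * bracket σ (wignerS hA (conjS φ) (tfShift z.2 z.1 g))) :
    IsExtendedMatrixOp g A σ T where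
  map_add u hu v hv := by
    ext φ
    change T (u + v) φ = T u φ + T v φ
    rw [hT _ (add_mem_modSpace_top hu hv), hT u hu, hT v hv, ← mul_add,
      ← integral_add (hσ.integrable_mul hu _) (hσ.integrable_mul hv _)]
    simp only [stft_add, add_mul]
  map_smul c u hu := by
    ext φ
    change T (c • u) φ = c * T u φ
    rw [hT _ (smul_mem_modSpace_top c hu), hT u hu, mul_left_comm, ← integral_const_mul c]
    simp only [stft_smul, mul_assoc]
  apply_schwartz f h := by
    refine ⟨wignerS hA h f, wignerS_eq_matrixWigner hA h f, ?_⟩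
    -- For fixed `h`, `f ↦ ⟨σ^A f, h⟩` is itself a tempered distribution, so the inversion formula
    -- for `f` reproduces it exactly.
    have h1 := normSq_mul_apply g f (matrixOpForm hA σ h)
    simp only [matrixOpForm_apply] at h1
    rw [bracket, hT _ (toTemperedDistribution_mem_modSpace g f ∞ ∞), conjS_conjS]
    simp only [stft_toTemperedDistribution]
    rw [← h1, ← mul_assoc, ← Complex.ofReal_mul, inv_mul_cancel₀ (normSq_pos hg).ne']
    simp
  tendsto u v hR hlim φ := by
    obtain ⟨R, hR⟩ := hR
    have hu : ∀ n, u n ∈ modSpace g ∞ ∞ := fun n => (hR n).trans_lt ENNReal.coe_lt_top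
    have hst : ∀ z : E × E, Tendsto (fun n => stft g (u n) z.2 z.1) atTop
        (𝓝 (stft g v z.2 z.1)) := fun z => hlim _
    have hle : ∀ n (z : E × E), ‖stft g (u n) z.2 z.1‖ₑ ≤ R := fun n z =>
      (enorm_stft_le_modNorm_top g (u n) z).trans (hR n)
    -- Convergence in `𝓢'` is pointwise convergence of the transforms, so the limit inherits the
    -- bound `R` and the formula for `T` applies to it.
    have hv : v ∈ modSpace g ∞ ∞ := mem_modSpace_top_of_bound fun z =>
      le_of_tendsto (hst z).enorm (Eventually.of_forall fun n => hle n z)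
    rw [hT v hv]
    simp only [hT _ (hu _)]
    refine Tendsto.const_mul _ (tendsto_integral_of_dominated_convergence
      (fun z => R * ‖bracket σ (wignerS hA (conjS φ) (tfShift z.2 z.1 g))‖)
      (fun n => (hσ.integrable_mul (hu n) _).1) ((hσ.integrable _).norm.const_mul _)
      (fun n => Eventually.of_forall fun z => ?_)
      (Eventually.of_forall fun z => (hst z).mul_const _))
    rw [norm_mul]
    refine mul_le_mul_of_nonneg_right ?_ (norm_nonneg _)
    have := hle n z
    rw [enorm_le_coe] at this
    exact_mod_cast this

/-- Boundedness of `σ^A` on all modulation spaces, for symbols in the Sjöstrand class. -/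
theorem exists_bound_matrixOp (hA : IsUnit A) (hreg : IsBlockLeftRegular A) (hg : g ≠ 0)
    {G : 𝓢(E₂, ℂ)} (hG : G ≠ 0) : ∃ C : ℝ≥0, ∀ σ ∈ modSpace G ∞ 1,
      ∃ T : 𝓢'(E, ℂ) → 𝓢'(E, ℂ), IsExtendedMatrixOp g A σ T ∧
        ∀ p q : ℝ≥0∞, 1 ≤ p → 1 ≤ q → ∀ u ∈ modSpace g p q,
          modNorm g p q (T u) ≤ C * modNorm G ∞ 1 σ * modNorm g p q u := by
  obtain ⟨L₁, L₂, M₁, M₂, C, hC⟩ := exists_kernel_majorant hA hreg g hG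
  obtain ⟨D, hD⟩ := exists_mixedNorm_lintegral_le L₁ L₂ M₁ M₂
  refine ⟨D * ((normSq g)⁻¹.toNNReal * C), fun σ hσ => ?_⟩
  obtain ⟨k, hk, hkint, hkle⟩ := hC σ
  have hkfin : ∫⁻ z, k z ≠ ∞ :=
    (hkint.trans_lt (ENNReal.mul_lt_top ENNReal.coe_lt_top hσ)).ne
  have hS := HasSummableCoefficients.of_majorant hg hk hkfin hkle
  obtain ⟨T, hT⟩ := hS.exists_extension
  refine ⟨T, hS.isExtendedMatrixOp hg hT, fun p q hp hq u hu => ?_⟩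
  set n : ℝ≥0∞ := ENNReal.ofReal (normSq g)⁻¹ with hn
  rw [modNorm_eq_mixedNorm g p q (T u), modNorm_eq_mixedNorm g p q u]
  -- Testing `T u` with `π(w)g` gives `V_g (T u)(w)`, dominated by the Gabor kernel applied to `|V_g
  -- u|`. The factor `n` is moved into the kernel.
  have hle : ∀ w : E × E, ‖stft g (T u) w.2 w.1‖ₑ ≤
      ∫⁻ z : E × E, ‖stft g u z.2 z.1‖ₑ * (n * k (L₁ w.1 + M₁ z.1, L₂ w.2 + M₂ z.2)) := by
    intro w
    rw [stft, bracket, hT u (modSpace_subset_top hg hp hq hu), conjS_conjS, enorm_mul,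
      ← ofReal_norm ((_ : ℝ) : ℂ), Complex.norm_real,
      Real.norm_of_nonneg (inv_nonneg.2 (normSq_pos hg).le), ← hn]
    calc n * ‖∫ z : E × E, stft g u z.2 z.1 *
            bracket σ (wignerS hA (tfShift w.2 w.1 g) (tfShift z.2 z.1 g))‖ₑ
        ≤ n * ∫⁻ z : E × E, ‖stft g u z.2 z.1‖ₑ * k (L₁ w.1 + M₁ z.1, L₂ w.2 + M₂ z.2) := by
          refine mul_le_mul_right ((enorm_integral_le_lintegral_enorm _).trans
            (lintegral_mono fun z => ?_)) _
          rw [enorm_mul]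
          exact mul_le_mul_right (hkle w z) _
      _ = _ := by
          rw [← lintegral_const_mul' _ _ ENNReal.ofReal_ne_top]
          simp only [hn, mul_left_comm]
  refine (mixedNorm_mono hle).trans ((hD p q hp hq _ (fun z => n * k z)
    (continuous_enorm_stft g u) (hk.const_mul n)).trans (mul_le_mul_left ?_ _))
  rw [lintegral_const_mul _ hk, ENNReal.coe_mul, ENNReal.coe_mul, mul_assoc, mul_assoc]
  exact mul_le_mul_right (mul_le_mul_right hkint _) _

end Extension

/-! ### Uniform control of the determinant factors. -/

theorem rpow_le_max_one {a s : ℝ} (ha : 0 ≤ a) (hs : 0 ≤ s) (hs1 : s ≤ 1) : a ^ s ≤ max 1 a := by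
  rcases le_total a 1 with h | h
  · exact (Real.rpow_le_one ha h hs).trans (le_max_left _ _)
  · exact (Real.rpow_le_rpow_of_exponent_le h hs1).trans ((Real.rpow_one a).trans_le
      (le_max_right _ _))

theorem toReal_inv_le_one {p : ℝ≥0∞} (hp : 1 ≤ p) : (p⁻¹).toReal ≤ 1 := by
  rw [← ENNReal.toReal_one]
  exact ENNReal.toReal_mono (by simp) (ENNReal.inv_le_one.2 hp)

/-- Exponents in `[0, 1]` keep each power below `max 1 a` or `max 1 b`, so a constant depending only
on the bases compensates the reciprocal for all exponents at once. -/
theorem one_le_max_mul_max_mul_inv {a b s t : ℝ} (ha : 0 < a) (hb : 0 < b) (hs : 0 ≤ s)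
    (hs1 : s ≤ 1) (ht : 0 ≤ t) (ht1 : t ≤ 1) : 1 ≤ max 1 a * max 1 b * (1 / (a ^ s * b ^ t)) := by
  rw [mul_one_div, one_le_div (by positivity)]
  exact mul_le_mul (rpow_le_max_one ha.le hs hs1) (rpow_le_max_one hb.le ht ht1) (by positivity)
    (by positivity)

end

end MatrixWigner

open MatrixWigner in
theorem mainTheorem9 (d : ℕ) (A : Matrix (Fin d ⊕ Fin d) (Fin d ⊕ Fin d) ℝ)
    (hA : IsUnit A) (hreg : IsBlockLeftRegular A)
    (g : 𝓢(EuclideanSpace ℝ (Fin d), ℂ)) (hg : g ≠ 0)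
    (G : 𝓢(EuclideanSpace ℝ (Fin d ⊕ Fin d), ℂ)) (hG : G ≠ 0) :
    ∃ C : ℝ, 0 < C ∧
      ∀ σ ∈ modSpace G ∞ 1,
        ∃ T : 𝓢'(EuclideanSpace ℝ (Fin d), ℂ) → 𝓢'(EuclideanSpace ℝ (Fin d), ℂ),
          IsExtendedMatrixOp g A σ T ∧
          ∀ p q : ℝ≥0∞, 1 ≤ p → 1 ≤ q → ∀ u ∈ modSpace g p q,
            T u ∈ modSpace g p q ∧
            modNorm g p q (T u) ≤
              ENNReal.ofReal (C *
                (1 / (|A.toBlocks₁₁.det| ^ (p.conjExponent⁻¹).toReal *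
                      |A.toBlocks₂₁.det| ^ (p⁻¹).toReal)) *
                (1 / (|(sharp A).toBlocks₁₂.det| ^ (q.conjExponent⁻¹).toReal *
                      |(sharp A).toBlocks₂₂.det| ^ (q⁻¹).toReal))) *
              modNorm G ∞ 1 σ * modNorm g p q u := by
  obtain ⟨h21, h22⟩ := isUnit_inv_blocks hA hreg
  have hdet : ∀ B : Matrix (Fin d) (Fin d) ℝ, IsUnit B → 0 < |B.det| := fun B hB =>
    abs_pos.2 ((Matrix.isUnit_iff_isUnit_det B).1 hB).ne_zero
  set a₁ := |A.toBlocks₁₁.det|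
  set a₂ := |A.toBlocks₂₁.det|
  set b₁ := |(sharp A).toBlocks₁₂.det|
  set b₂ := |(sharp A).toBlocks₂₂.det|
  have ha₁ : 0 < a₁ := hdet _ hreg.1
  have ha₂ : 0 < a₂ := hdet _ hreg.2
  -- The blocks of the inverse transpose are transposed blocks of `A⁻¹` with the indices exchanged.
  have hb₁ : 0 < b₁ := hdet _ ((Matrix.isUnit_transpose _).2 h21)
  have hb₂ : 0 < b₂ := hdet _ ((Matrix.isUnit_transpose _).2 h22)
  obtain ⟨C, hC⟩ := exists_bound_matrixOp hA hreg hg hG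
  -- The maxima compensate the determinant factors for all `p` and `q`; the summand `1` ensures
  -- positivity when `C = 0`.
  refine ⟨(C + 1) * (max 1 a₁ * max 1 a₂) * (max 1 b₁ * max 1 b₂), by positivity,
    fun σ hσ => ?_⟩
  obtain ⟨T, hT, hbound⟩ := hC σ hσ
  refine ⟨T, hT, fun p q hp hq u hu => ⟨?_, ?_⟩⟩
  · exact (hbound p q hp hq u hu).trans_lt
      (ENNReal.mul_lt_top (ENNReal.mul_lt_top ENNReal.coe_lt_top hσ) hu)
  refine (hbound p q hp hq u hu).trans ?_
  gcongr
  have hconj : ∀ r : ℝ≥0∞, 1 ≤ r.conjExponent := fun r => le_self_add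
  have h1 := one_le_max_mul_max_mul_inv ha₁ ha₂ ENNReal.toReal_nonneg
    (toReal_inv_le_one (hconj p)) ENNReal.toReal_nonneg (toReal_inv_le_one hp)
  have h2 := one_le_max_mul_max_mul_inv hb₁ hb₂ ENNReal.toReal_nonneg
    (toReal_inv_le_one (hconj q)) ENNReal.toReal_nonneg (toReal_inv_le_one hq)
  rw [← ENNReal.ofReal_coe_nnreal]
  refine ENNReal.ofReal_le_ofReal ?_
  calc (C : ℝ) ≤ (C + 1) * (1 * 1) := by linarith
    _ ≤ _ := mul_le_mul_of_nonneg_left (mul_le_mul h1 h2 zero_le_one (zero_le_one.trans h1))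
      (by positivity)
    _ = _ := by ring
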